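/- Let $R$ be a commutative ring, $\delta\in R$ invertible and $n\ge 0$. Let $\sigma$ be the reflection in the vertical axis, and let $B=B(C_n,R,\delta)$ be the Brauer algebra of type $C_n$: the subalgebra of the (type $A$) Brauer algebra on $2n$ strands with loop parameter $\delta$ that is spanned by the Brauer diagrams fixed by $\sigma$. For $0\le k\le n$ let $V(2n,k)$ be the free $R$-module on the symmetric $(2n,k)$-dangles, i.e. the $\sigma$-invariant partitions of $\{1,\dots,2n\}$ into $k$ two-element and $2n-2k$ one-element subsets, and let $H_{n-k}$ be the hyperoctahedral group, realised as the group of permutations of $\{1,\dots,2n-2k\}$ that commute with $i\mapsto 2n-2k+1-i$. Cutting the vertical lines of a symmetric diagram with $k$ northern arcs identifies the span of these diagrams with $V(2n,k)\otimes V(2n,k)\otimes RH_{n-k}$ (northern dangle, southern dangle, permutation of the vertical lines). A *cell chain* of an $R$-algebra $A$ with an $R$-linear anti-involution $i$ is a decomposition $A=\bigoplus_{l\in\Lambda}J'_l$ as an $R$-module, $\Lambda$ a finite linearly ordered set, such that $i(J'_l)=J'_l$, each $J_l=\bigoplus_{m\le l}J'_m$ is a two-sided ideal, and with $J_{<l}=\bigoplus_{m<l}J'_m$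 the ideal $J_l/J_{<l}$ of $A/J_{<l}$ is a cell ideal: it contains a left ideal $\Delta_l$ of $A/J_{<l}$, finitely generated and free over $R$, with an isomorphism of bimodules $J_l/J_{<l}\cong\Delta_l\otimes_R i(\Delta_l)$ that carries $i$ to $x\otimes y\mapsto i(y)\otimes i(x)$. The $\Delta_l$ are the *cell modules* (standard modules) of the chain. For each $0\le k\le n$ let a cell chain of $RH_{n-k}$ with respect to $g\mapsto g^{-1}$ be given, with index set $\Lambda_k$, summands $H'_\mu$ and standard modules $\Delta(\mu)$ $(\mu\in\Lambda_k)$, and let $v_k\in V(2n,k)$ be an element with zero annihilator in $R$ (if $R$ is a field or an integral domain: any nonzero element). Then $B$ has a cell chain with respect to the reflection in the horizontal axis, indexed by the pairs $(k,\mu)$ with $0\le k\le n$, $\mu\in\Lambda_k$ (ordered lexicographically, larger $k$ first), whose summand at $(k,\mu)$ is $V(2n,k)\otimes V(2n,k)\otimes H'_\mu$, and whose cell modules are exactly the modules $$\Delta(\mu,k)=V(2n,k)\otimes v_k\otimes\Delta(\mu),\qquad 0\le k\le n,\ \mu\in\Lambda_k .$$ More precisely, $a\otimes[h]\mapsto[a\otimes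 v_k\otimes h]$ is a well-defined isomorphism of $R$-modules from $V(2n,k)\otimes_R\Delta(\mu)$ onto the cell module at $(k,\mu)$. -/

import Mathlib

open scoped TensorProduct

noncomputable section

namespace BrauerC

/-! ### Stacking diagrams -/

section Stack

variable {X : Type*}

/-- A diagram on northern nodes `X` and southern nodes `X` is a partition of `X ⊕ X`. Two stacked
diagrams have the three rows of nodes `X ⊕ X ⊕ X` (top, middle, bottom); the upper diagram lives on
the top and middle rows. -/
def topMid : X ⊕ X → X ⊕ X ⊕ X := Sum.map id Sum.inl
/-- The lower diagram lives on the middle and bottom rows. -/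
def midBot : X ⊕ X → X ⊕ X ⊕ X := Sum.inr
/-- The composite lives on the top and bottom rows. -/
def topBot : X ⊕ X → X ⊕ X ⊕ X := Sum.map id Sum.inr

/-- Two nodes are joined in the upper or in the lower diagram. -/
inductive Step (p q : Setoid (X ⊕ X)) : X ⊕ X ⊕ X → X ⊕ X ⊕ X → Prop
  | upper {a b : X ⊕ X} : p a b → Step p q (topMid a) (topMid b)
  | lower {a b : X ⊕ X} : q a b → Step p q (midBot a) (midBot b)

/-- The connected components of the stacked diagrams. -/
def stack (p q : Setoid (X ⊕ X)) : Setoid (X ⊕ X ⊕ X) := Relation.EqvGen.setoid (Step p q)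

/-- The composite: the nodes of the outer rows that are connected after stacking. -/
def comp (p q : Setoid (X ⊕ X)) : Setoid (X ⊕ X) := (stack p q).comap topBot

/-- The closed loops: the components contained in the middle row. -/
def loopClasses (p q : Setoid (X ⊕ X)) : Set (Set (X ⊕ X ⊕ X)) :=
  {C | C ∈ (stack p q).classes ∧ ∀ x ∈ C, ∃ a, x = Sum.inr (Sum.inl a)}

/-- The number of closed loops. -/
def loops (p q : Setoid (X ⊕ X)) : ℕ := (loopClasses p q).ncard

/-- Reflection in the horizontal axis. -/
def flip (p : Setoid (X ⊕ X)) : Setoid (X ⊕ X) := p.comap Sum.swap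

/-- The diagram of vertical lines. -/
def idRel : Setoid (X ⊕ X) := Setoid.ker (Sum.elim id id)

theorem stack_ind {p q : Setoid (X ⊕ X)} (s : Setoid (X ⊕ X ⊕ X))
    (hp : ∀ a b, p a b → s (topMid a) (topMid b))
    (hq : ∀ a b, q a b → s (midBot a) (midBot b)) {x y} (h : stack p q x y) : s x y := by
  induction h with
  | rel x y h => cases h with
    | upper h => exact hp _ _ h
    | lower h => exact hq _ _ h
  | refl x => exact s.refl _
  | symm x y _ ih => exact s.symm ih
  | trans x y z _ _ h1 h2 => exact s.trans h1 h2

theorem stack_upper {p q : Setoid (X ⊕ X)} {a b} (h : p a b) :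
    stack p q (topMid a) (topMid b) := Relation.EqvGen.rel _ _ (.upper h)

theorem stack_lower {p q : Setoid (X ⊕ X)} {a b} (h : q a b) :
    stack p q (midBot a) (midBot b) := Relation.EqvGen.rel _ _ (.lower h)

/-! #### Reflection in the horizontal axis -/

def swap3 : X ⊕ X ⊕ X → X ⊕ X ⊕ X
  | .inl a => .inr (.inr a)
  | .inr (.inl a) => .inr (.inl a)
  | .inr (.inr a) => .inl a

theorem swap3_swap3 (x : X ⊕ X ⊕ X) : swap3 (swap3 x) = x := by
  rcases x with a | a | a <;> rfl

theorem swap3_topMid (a : X ⊕ X) : swap3 (topMid a) = midBot a.swap := by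
  rcases a with a | a <;> rfl

theorem swap3_midBot (a : X ⊕ X) : swap3 (midBot a) = topMid a.swap := by
  rcases a with a | a <;> rfl

theorem swap3_topBot (a : X ⊕ X) : swap3 (topBot a) = topBot a.swap := by
  rcases a with a | a <;> rfl

theorem flip_flip (p : Setoid (X ⊕ X)) : flip (flip p) = p := by
  ext x y
  change p x.swap.swap y.swap.swap ↔ p x y
  rw [Sum.swap_swap, Sum.swap_swap]

theorem stack_flip_imp (p q : Setoid (X ⊕ X)) {x y} (h : stack (flip q) (flip p) x y) :
    stack p q (swap3 x) (swap3 y) := by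
  refine stack_ind ((stack p q).comap swap3) ?_ ?_ h
  · intro a b h
    simp only [Setoid.comap_rel, swap3_topMid]
    exact stack_lower h
  · intro a b h
    simp only [Setoid.comap_rel, swap3_midBot]
    exact stack_upper h

theorem stack_flip (p q : Setoid (X ⊕ X)) (x y) :
    stack (flip q) (flip p) x y ↔ stack p q (swap3 x) (swap3 y) := by
  refine ⟨stack_flip_imp p q, fun h => ?_⟩
  have := stack_flip_imp (flip q) (flip p) (x := swap3 x) (y := swap3 y)
    (by rwa [flip_flip, flip_flip])
  simpa [swap3_swap3] using this

theorem comp_flip (p q : Setoid (X ⊕ X)) : comp (flip q) (flip p) = flip (comp p q) := by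
  ext x y
  have := stack_flip p q (topBot x) (topBot y)
  rwa [swap3_topBot, swap3_topBot] at this

theorem loops_flip (p q : Setoid (X ⊕ X)) : loops (flip q) (flip p) = loops p q := by
  have inj : Function.Injective (fun C : Set (X ⊕ X ⊕ X) => swap3 ⁻¹' C) := by
    intro C D h
    ext x
    have := Set.ext_iff.1 h (swap3 x)
    simpa [swap3_swap3] using this
  unfold loops
  rw [← Set.ncard_image_of_injective (loopClasses p q) inj]
  congr 1
  have key : ∀ p q : Setoid (X ⊕ X), ∀ C ∈ loopClasses p q,
      swap3 ⁻¹' C ∈ loopClasses (flip q) (flip p) := by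
    rintro p q C ⟨⟨z, rfl⟩, hC⟩
    refine ⟨⟨swap3 z, ?_⟩, ?_⟩
    · ext x
      have := stack_flip p q x (swap3 z)
      simpa [swap3_swap3] using this.symm
    · intro x hx
      obtain ⟨a, ha⟩ := hC _ hx
      refine ⟨a, ?_⟩
      rw [← swap3_swap3 x, ha]; rfl
  ext C
  constructor
  · intro h
    refine ⟨swap3 ⁻¹' C, ?_, ?_⟩
    · have := key _ _ C h
      simpa [flip_flip] using this
    · ext x; simp [swap3_swap3]
  · rintro ⟨D, hD, rfl⟩
    exact key _ _ D hD

/-! #### The identity diagram -/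

def collapse : X ⊕ X ⊕ X → X ⊕ X
  | .inl a => .inl a
  | .inr (.inl a) => .inl a
  | .inr (.inr a) => .inr a

theorem stack_id (d : Setoid (X ⊕ X)) (x y) :
    stack idRel d x y ↔ d (collapse x) (collapse y) := by
  constructor
  · intro h
    refine stack_ind (d.comap collapse) ?_ ?_ h
    · intro a b h
      have : collapse (topMid a) = collapse (topMid b) := by
        rcases a with a | a <;> rcases b with b | b <;>
          · change a = b at h
            subst h; rfl
      simp only [Setoid.comap_rel, this]
      exact d.refl _
    · intro a b h
      rcases a with a | a <;> rcases b with b | b <;> exact h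
  · intro h
    have aux : ∀ z, stack idRel d z (midBot (collapse z)) := by
      rintro (a | a | a)
      · exact stack_upper (a := .inl a) (b := .inr a) rfl
      · exact (stack idRel d).refl _
      · exact (stack idRel d).refl _
    exact (stack idRel d).trans (aux x)
      ((stack idRel d).trans (stack_lower h) ((stack idRel d).symm (aux y)))

theorem id_comp (d : Setoid (X ⊕ X)) : comp idRel d = d := by
  ext x y
  rw [comp, Setoid.comap_rel, stack_id]
  rcases x with x | x <;> rcases y with y | y <;> rfl

theorem id_loops (d : Setoid (X ⊕ X)) : loops idRel d = 0 := by
  have : loopClasses idRel d = ∅ := by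
    ext C
    simp only [Set.mem_empty_iff_false, iff_false]
    rintro ⟨⟨z, rfl⟩, hC⟩
    obtain ⟨a, rfl⟩ := hC z ((stack idRel d).refl z)
    obtain ⟨b, hb⟩ := hC (.inl a) ((stack_id d _ _).2 (d.refl _))
    exact absurd hb (by simp)
  simp [loops, this]

theorem flip_id : flip (idRel : Setoid (X ⊕ X)) = idRel := by
  ext x y
  rcases x with x | x <;> rcases y with y | y <;> rfl

theorem comp_id (d : Setoid (X ⊕ X)) : comp d idRel = d := by
  rw [← flip_flip (comp d idRel), ← comp_flip, flip_id, id_comp, flip_flip]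

theorem loops_id (d : Setoid (X ⊕ X)) : loops d idRel = 0 := by
  rw [← loops_flip, flip_id, id_loops]

/-! #### Associativity -/

inductive Step3 (p q r : Setoid (X ⊕ X)) : X ⊕ X ⊕ X ⊕ X → X ⊕ X ⊕ X ⊕ X → Prop
  | one {a b : X ⊕ X} : p a b → Step3 p q r (Sum.map id Sum.inl a) (Sum.map id Sum.inl b)
  | two {a b : X ⊕ X} : q a b →
      Step3 p q r (.inr (Sum.map id Sum.inl a)) (.inr (Sum.map id Sum.inl b))
  | three {a b : X ⊕ X} : r a b → Step3 p q r (.inr (.inr a)) (.inr (.inr b))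

def stack3 (p q r : Setoid (X ⊕ X)) : Setoid (X ⊕ X ⊕ X ⊕ X) :=
  Relation.EqvGen.setoid (Step3 p q r)

def incl : X ⊕ X ⊕ X → X ⊕ X ⊕ X ⊕ X := Sum.map id (Sum.map id Sum.inl)
def skip : X ⊕ X ⊕ X → X ⊕ X ⊕ X ⊕ X := Sum.map id Sum.inr
def ends : X ⊕ X → X ⊕ X ⊕ X ⊕ X := Sum.map id (Sum.inr ∘ Sum.inr)
def loop3Classes (p q r : Setoid (X ⊕ X)) : Set (Set (X ⊕ X ⊕ X ⊕ X)) :=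
  {C | C ∈ (stack3 p q r).classes ∧
    ∀ x ∈ C, (∃ a, x = .inr (.inl a)) ∨ ∃ a, x = .inr (.inr (.inl a))}

theorem stack3_ind {p q r : Setoid (X ⊕ X)} (s : Setoid (X ⊕ X ⊕ X ⊕ X))
    (h : ∀ x y, Step3 p q r x y → s x y) {x y} (hxy : stack3 p q r x y) : s x y := by
  induction hxy with
  | rel x y h' => exact h _ _ h'
  | refl x => exact s.refl _
  | symm x y _ ih => exact s.symm ih
  | trans x y z _ _ h1 h2 => exact s.trans h1 h2

theorem incl_inj : Function.Injective (incl : X ⊕ X ⊕ X → _) := by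
  rintro (a | a | a) (b | b | b) h <;> simp_all [incl]

theorem skip_inj : Function.Injective (skip : X ⊕ X ⊕ X → _) := by
  rintro (a | a | a) (b | b | b) h <;> simp_all [skip]

theorem stack3_incl {p q r : Setoid (X ⊕ X)} {x y} (h : stack p q x y) :
    stack3 p q r (incl x) (incl y) := by
  refine stack_ind ((stack3 p q r).comap incl) ?_ ?_ h
  · intro a b h
    have := Relation.EqvGen.rel _ _ (Step3.one (q := q) (r := r) h)
    rcases a with a | a <;> rcases b with b | b <;> exact this
  · intro a b h
    have := Relation.EqvGen.rel _ _ (Step3.two (p := p) (r := r) h)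
    rcases a with a | a <;> rcases b with b | b <;> exact this

theorem stack3_skip {p q r : Setoid (X ⊕ X)} {x y} (h : stack (comp p q) r x y) :
    stack3 p q r (skip x) (skip y) := by
  refine stack_ind ((stack3 p q r).comap skip) ?_ ?_ h
  · intro a b h
    have := stack3_incl (r := r) h
    rcases a with a | a <;> rcases b with b | b <;> exact this
  · intro a b h
    have := Relation.EqvGen.rel _ _ (Step3.three (p := p) (q := q) h)
    rcases a with a | a <;> rcases b with b | b <;> exact this

/-- Connection inside the upper two diagrams. -/
def up3 (p q : Setoid (X ⊕ X)) (x y : X ⊕ X ⊕ X ⊕ X) : Prop :=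
  x = y ∨ ∃ a b, stack p q a b ∧ x = incl a ∧ y = incl b

theorem up3_trans {p q : Setoid (X ⊕ X)} {x y z} (h : up3 p q x y) (h' : up3 p q y z) :
    up3 p q x z := by
  rcases h with rfl | ⟨a, b, h, rfl, rfl⟩
  · exact h'
  rcases h' with rfl | ⟨c, d, h', hc, rfl⟩
  · exact .inr ⟨_, _, h, rfl, rfl⟩
  · obtain rfl := incl_inj hc
    exact .inr ⟨_, _, (stack p q).trans h h', rfl, rfl⟩

theorem up3_symm {p q : Setoid (X ⊕ X)} {x y} (h : up3 p q x y) : up3 p q y x := by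
  rcases h with rfl | ⟨a, b, h, rfl, rfl⟩
  · exact .inl rfl
  · exact .inr ⟨_, _, (stack p q).symm h, rfl, rfl⟩

theorem up3_skip {p q r : Setoid (X ⊕ X)} {x y} (h : up3 p q (skip x) (skip y)) :
    stack (comp p q) r x y := by
  rcases h with h | ⟨a, b, h, hx, hy⟩
  · rw [skip_inj h]
  · obtain ⟨c, rfl, rfl⟩ : ∃ c, x = topMid c ∧ a = topBot c := by
      rcases x with x | x | x <;> rcases a with a | a | a <;> simp [skip, incl] at hx <;> subst hx
      · exact ⟨.inl _, rfl, rfl⟩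
      · exact ⟨.inr _, rfl, rfl⟩
    obtain ⟨d, rfl, rfl⟩ : ∃ c, y = topMid c ∧ b = topBot c := by
      rcases y with x | x | x <;> rcases b with a | a | a <;> simp [skip, incl] at hy <;> subst hy
      · exact ⟨.inl _, rfl, rfl⟩
      · exact ⟨.inr _, rfl, rfl⟩
    exact stack_upper h

/-- A point connected to a point of the outer three rows is connected, inside the upper two
diagrams, to a point of these rows. -/
theorem stack3_reach {p q r : Setoid (X ⊕ X)} {x y} (h : stack3 p q r x y) :
    up3 p q x y ∨ ∃ s t, up3 p q x (skip s) ∧ stack (comp p q) r s t ∧ up3 p q (skip t) y := by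
  induction h with
  | rel x y h =>
    cases h with
    | @one a b h =>
      refine .inl (.inr ⟨topMid a, topMid b, stack_upper h, ?_, ?_⟩)
      · rcases a with a | a <;> rfl
      · rcases b with a | a <;> rfl
    | @two a b h =>
      refine .inl (.inr ⟨midBot a, midBot b, stack_lower h, ?_, ?_⟩)
      · rcases a with a | a <;> rfl
      · rcases b with a | a <;> rfl
    | @three a b h =>
      exact .inr ⟨midBot a, midBot b, .inl rfl, stack_lower h, .inl rfl⟩
  | refl x => exact .inl (.inl rfl)
  | symm x y _ ih =>
    rcases ih with h | ⟨s, t, h1, h2, h3⟩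
    · exact .inl (up3_symm h)
    · exact .inr ⟨t, s, up3_symm h3, Setoid.symm' _ h2, up3_symm h1⟩
  | trans x y z _ _ h h' =>
    rcases h with h | ⟨s, t, h1, h2, h3⟩
    · rcases h' with h' | ⟨s', t', h1', h2', h3'⟩
      · exact .inl (up3_trans h h')
      · exact .inr ⟨s', t', up3_trans h h1', h2', h3'⟩
    · rcases h' with h' | ⟨s', t', h1', h2', h3'⟩
      · exact .inr ⟨s, t, h1, h2, up3_trans h3 h'⟩
      · exact .inr ⟨s, t', h1, Setoid.trans' _ h2
          (Setoid.trans' _ (up3_skip (up3_trans h3 h1')) h2'), h3'⟩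

theorem stack3_skip_iff {p q r : Setoid (X ⊕ X)} {x y} :
    stack3 p q r (skip x) (skip y) ↔ stack (comp p q) r x y := by
  refine ⟨fun h => ?_, stack3_skip⟩
  rcases stack3_reach h with h | ⟨s, t, h1, h2, h3⟩
  · exact up3_skip h
  · exact Setoid.trans' _ (up3_skip h1) (Setoid.trans' _ h2 (up3_skip h3))

theorem comp_comp_left (p q r : Setoid (X ⊕ X)) :
    comp (comp p q) r = (stack3 p q r).comap ends := by
  ext x y
  rw [comp, Setoid.comap_rel, Setoid.comap_rel, ← stack3_skip_iff]
  rcases x with x | x <;> rcases y with y | y <;> rfl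

theorem up3_stack3 {p q r : Setoid (X ⊕ X)} {x y} (h : up3 p q x y) : stack3 p q r x y := by
  rcases h with rfl | ⟨a, b, h, rfl, rfl⟩
  · exact Setoid.refl' _ _
  · exact stack3_incl h

theorem loops_left [Finite X] (p q r : Setoid (X ⊕ X)) :
    loops p q + loops (comp p q) r = (loop3Classes p q r).ncard := by
  classical
  set A : Set (Set (X ⊕ X ⊕ X ⊕ X)) :=
    {C | C ∈ loop3Classes p q r ∧ ∀ x ∈ C, ∃ a, x = .inr (.inl a)} with hA
  set B : Set (Set (X ⊕ X ⊕ X ⊕ X)) :=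
    {C | C ∈ loop3Classes p q r ∧ ∃ a, .inr (.inr (.inl a)) ∈ C} with hB
  have hAB : loop3Classes p q r = A ∪ B := by
    ext C
    constructor
    · intro h
      by_cases h' : ∃ a, (.inr (.inr (.inl a)) : X ⊕ X ⊕ X ⊕ X) ∈ C
      · exact .inr ⟨h, h'⟩
      · refine .inl ⟨h, fun x hx => ?_⟩
        rcases h.2 x hx with h1 | ⟨a, rfl⟩
        · exact h1
        · exact absurd ⟨a, hx⟩ h'
    · rintro (h | h) <;> exact h.1
  have hdisj : Disjoint A B := by
    rw [Set.disjoint_left]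
    rintro C ⟨_, h⟩ ⟨_, a, ha⟩
    obtain ⟨b, hb⟩ := h _ ha
    simp at hb
  rw [hAB, Set.ncard_union_eq hdisj (Set.toFinite _) (Set.toFinite _)]
  congr 1
  · -- classes in the first inner row
    rw [loops, ← Set.ncard_image_of_injective (loopClasses p q) (Set.image_injective.2 incl_inj)]
    congr 1
    have noskip : ∀ a : X, ∀ s : X ⊕ X ⊕ X, skip s ≠ .inr (.inl a) := by
      rintro a (s | s | s) <;> simp [skip]
    ext C
    constructor
    · rintro ⟨D, ⟨⟨z, rfl⟩, hD⟩, rfl⟩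
      obtain ⟨a, rfl⟩ := hD z (Setoid.refl' (stack p q) z)
      have key : ∀ x, stack3 p q r x (incl (.inr (.inl a))) →
          ∃ y, stack p q y (.inr (.inl a)) ∧ incl y = x := by
        intro x hx
        have hu : up3 p q x (incl (.inr (.inl a))) → ∃ y, stack p q y (.inr (.inl a)) ∧ incl y = x := by
          rintro (rfl | ⟨c, d, h, rfl, hd⟩)
          · exact ⟨_, Setoid.refl' _ _, rfl⟩
          · obtain rfl := incl_inj hd
            exact ⟨_, h, rfl⟩
        rcases stack3_reach hx with h | ⟨s, t, h1, h2, h3⟩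
        · exact hu h
        · exfalso
          rcases h3 with h3 | ⟨c, d, h, hc, hd⟩
          · exact noskip a t h3
          · obtain rfl := incl_inj hd
            obtain ⟨b, rfl⟩ := hD c h
            exact noskip b t hc
      have hcl : incl '' {x | stack p q x (.inr (.inl a))} =
          {x | stack3 p q r x (incl (.inr (.inl a)))} := by
        ext x
        constructor
        · rintro ⟨y, hy, rfl⟩
          exact stack3_incl hy
        · intro hx
          obtain ⟨y, hy, rfl⟩ := key x hx
          exact ⟨y, hy, rfl⟩
      have hrow : ∀ x ∈ incl '' {x | stack p q x (.inr (.inl a))},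
          ∃ a : X, x = .inr (.inl a) := by
        rintro _ ⟨y, hy, rfl⟩
        obtain ⟨b, rfl⟩ := hD y hy
        exact ⟨b, rfl⟩
      exact ⟨⟨⟨_, hcl⟩, fun x hx => .inl (hrow x hx)⟩, hrow⟩
    · rintro ⟨⟨⟨z, rfl⟩, -⟩, hC⟩
      obtain ⟨a, rfl⟩ := hC z (Setoid.refl' (stack3 p q r) z)
      have hD : ∀ x, stack p q x (.inr (.inl a)) → ∃ b, x = .inr (.inl b) := by
        intro x hx
        obtain ⟨b, hb⟩ := hC (incl x) (stack3_incl hx)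
        exact ⟨b, incl_inj hb⟩
      refine ⟨{x | stack p q x (.inr (.inl a))}, ⟨⟨_, rfl⟩, hD⟩, ?_⟩
      ext x
      constructor
      · rintro ⟨y, hy, rfl⟩
        exact stack3_incl hy
      · intro hx
        rcases stack3_reach hx with h | ⟨s, t, h1, h2, h3⟩
        · rcases h with rfl | ⟨c, d, h, rfl, hd⟩
          · exact ⟨.inr (.inl a), Setoid.refl' (stack p q) _, rfl⟩
          · obtain rfl : d = .inr (.inl a) := incl_inj hd.symm
            exact ⟨c, h, rfl⟩
        · exfalso
          obtain ⟨b, hb⟩ := hC (skip t) (up3_stack3 h3)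
          exact noskip b t hb
  · -- classes meeting the second inner row
    have hinj : Set.InjOn (fun C : Set (X ⊕ X ⊕ X ⊕ X) => skip ⁻¹' C) B := by
      rintro C ⟨⟨⟨z, rfl⟩, -⟩, a, ha⟩ D ⟨⟨⟨w, rfl⟩, -⟩, b, hb⟩ h
      have h1 := (Set.ext_iff.1 h (.inr (.inl a))).1 ha
      change stack3 p q r _ z at ha
      change stack3 p q r _ w at h1
      have hzw : stack3 p q r z w := Setoid.trans' _ (Setoid.symm' _ ha) h1
      ext x
      exact ⟨fun hx => Setoid.trans' _ hx hzw,
        fun hx => Setoid.trans' _ hx (Setoid.symm' _ hzw)⟩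
    rw [loops, ← hinj.ncard_image]
    congr 1
    ext D
    constructor
    · rintro ⟨⟨z, rfl⟩, hD⟩
      obtain ⟨a, rfl⟩ := hD z (Setoid.refl' (stack (comp p q) r) z)
      have hsk : ∀ s, stack3 p q r (skip s) (skip (.inr (.inl a))) → ∃ b, s = .inr (.inl b) :=
        fun s hs => hD s (stack3_skip_iff.1 hs)
      refine ⟨{x | stack3 p q r x (skip (.inr (.inl a)))}, ⟨⟨⟨_, rfl⟩, ?_⟩, a, ?_⟩, ?_⟩
      · rintro (x | x | x | x) hx
        · obtain ⟨b, hb⟩ := hsk (.inl x) hx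
          simp at hb
        · exact .inl ⟨_, rfl⟩
        · exact .inr ⟨_, rfl⟩
        · obtain ⟨b, hb⟩ := hsk (.inr (.inr x)) hx
          simp at hb
      · exact Setoid.refl' (stack3 p q r) _
      · ext s
        exact stack3_skip_iff
    · rintro ⟨C, ⟨⟨⟨z, rfl⟩, hC⟩, a, ha⟩, rfl⟩
      change stack3 p q r (skip (.inr (.inl a))) z at ha
      refine ⟨⟨.inr (.inl a), ?_⟩, ?_⟩
      · ext s
        constructor
        · intro hs
          exact stack3_skip_iff.1 (Setoid.trans' _ hs (Setoid.symm' _ ha))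
        · intro hs
          exact Setoid.trans' _ (stack3_skip_iff.2 hs) ha
      · rintro (s | s | s) hs
        · rcases hC _ hs with ⟨b, hb⟩ | ⟨b, hb⟩ <;> simp [skip] at hb
        · exact ⟨s, rfl⟩
        · rcases hC _ hs with ⟨b, hb⟩ | ⟨b, hb⟩ <;> simp [skip] at hb

def swap4 : X ⊕ X ⊕ X ⊕ X → X ⊕ X ⊕ X ⊕ X
  | .inl a => .inr (.inr (.inr a))
  | .inr (.inl a) => .inr (.inr (.inl a))
  | .inr (.inr (.inl a)) => .inr (.inl a)
  | .inr (.inr (.inr a)) => .inl a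

theorem swap4_swap4 (x : X ⊕ X ⊕ X ⊕ X) : swap4 (swap4 x) = x := by
  rcases x with a | a | a | a <;> rfl

theorem stack3_flip_imp (p q r : Setoid (X ⊕ X)) {x y}
    (h : stack3 (flip r) (flip q) (flip p) x y) : stack3 p q r (swap4 x) (swap4 y) := by
  refine stack3_ind ((stack3 p q r).comap swap4) ?_ h
  intro x y h
  cases h with
  | @one a b h =>
    have := Relation.EqvGen.rel _ _ (Step3.three (p := p) (q := q) (show r a.swap b.swap from h))
    rcases a with a | a <;> rcases b with b | b <;> exact this
  | @two a b h =>
    have := Relation.EqvGen.rel _ _ (Step3.two (p := p) (r := r) (show q a.swap b.swap from h))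
    rcases a with a | a <;> rcases b with b | b <;> exact this
  | @three a b h =>
    have := Relation.EqvGen.rel _ _ (Step3.one (q := q) (r := r) (show p a.swap b.swap from h))
    rcases a with a | a <;> rcases b with b | b <;> exact this

theorem stack3_flip (p q r : Setoid (X ⊕ X)) (x y) :
    stack3 (flip r) (flip q) (flip p) x y ↔ stack3 p q r (swap4 x) (swap4 y) := by
  refine ⟨stack3_flip_imp p q r, fun h => ?_⟩
  have := stack3_flip_imp (flip r) (flip q) (flip p) (x := swap4 x) (y := swap4 y)
    (by rwa [flip_flip, flip_flip, flip_flip])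
  simpa [swap4_swap4] using this

theorem loop3_flip (p q r : Setoid (X ⊕ X)) :
    (loop3Classes (flip r) (flip q) (flip p)).ncard = (loop3Classes p q r).ncard := by
  have inj : Function.Injective (fun C : Set (X ⊕ X ⊕ X ⊕ X) => swap4 ⁻¹' C) := by
    intro C D h
    ext x
    have := Set.ext_iff.1 h (swap4 x)
    simpa [swap4_swap4] using this
  rw [← Set.ncard_image_of_injective (loop3Classes p q r) inj]
  congr 1
  have key : ∀ p q r : Setoid (X ⊕ X), ∀ C ∈ loop3Classes p q r,
      swap4 ⁻¹' C ∈ loop3Classes (flip r) (flip q) (flip p) := by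
    rintro p q r C ⟨⟨z, rfl⟩, hC⟩
    refine ⟨⟨swap4 z, ?_⟩, ?_⟩
    · ext x
      have := stack3_flip p q r x (swap4 z)
      simpa [swap4_swap4] using this.symm
    · intro x hx
      rcases hC _ hx with ⟨a, ha⟩ | ⟨a, ha⟩
      · refine .inr ⟨a, ?_⟩
        rw [← swap4_swap4 x, ha]; rfl
      · refine .inl ⟨a, ?_⟩
        rw [← swap4_swap4 x, ha]; rfl
  ext C
  constructor
  · intro h
    refine ⟨swap4 ⁻¹' C, ?_, ?_⟩
    · have := key _ _ _ C h
      simpa [flip_flip] using this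
    · ext x; simp [swap4_swap4]
  · rintro ⟨D, hD, rfl⟩
    exact key _ _ _ D hD

theorem comp_comp_right (p q r : Setoid (X ⊕ X)) :
    comp p (comp q r) = (stack3 p q r).comap ends := by
  rw [← flip_flip (comp p (comp q r)), ← comp_flip, ← comp_flip q r, comp_comp_left]
  ext x y
  rw [flip, Setoid.comap_rel, Setoid.comap_rel, stack3_flip, Setoid.comap_rel]
  rcases x with x | x <;> rcases y with y | y <;> rfl

theorem comp_assoc (p q r : Setoid (X ⊕ X)) : comp (comp p q) r = comp p (comp q r) := by
  rw [comp_comp_left, comp_comp_right]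

theorem loops_assoc [Finite X] (p q r : Setoid (X ⊕ X)) :
    loops p q + loops (comp p q) r = loops q r + loops p (comp q r) := by
  rw [loops_left, ← loop3_flip, ← loops_left, loops_flip, comp_flip, loops_flip]

/-! #### Perfect matchings are closed under composition -/

/-- Every block of the partition has exactly two elements. -/
def IsMatching {Y : Type*} (p : Setoid Y) : Prop := ∀ x, ∃! y, y ≠ x ∧ p y x

theorem idRel_isMatching : IsMatching (idRel : Setoid (X ⊕ X)) := by
  rintro (x | x)
  · refine ⟨.inr x, ⟨by simp, rfl⟩, ?_⟩
    rintro (y | y) ⟨h1, h2⟩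
    · change y = x at h2
      simp [h2] at h1
    · change y = x at h2
      simp [h2]
  · refine ⟨.inl x, ⟨by simp, rfl⟩, ?_⟩
    rintro (y | y) ⟨h1, h2⟩
    · change y = x at h2
      simp [h2]
    · change y = x at h2
      simp [h2] at h1

theorem flip_isMatching {p : Setoid (X ⊕ X)} (hp : IsMatching p) : IsMatching (flip p) := by
  intro x
  obtain ⟨y, ⟨h1, h2⟩, h3⟩ := hp x.swap
  refine ⟨y.swap, ⟨?_, ?_⟩, ?_⟩
  · rintro rfl; simp at h1
  · change p y.swap.swap x.swap
    rwa [Sum.swap_swap]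
  · rintro z ⟨h4, h5⟩
    have : z.swap = y := h3 z.swap ⟨fun h => h4 (by simpa using congrArg Sum.swap h), h5⟩
    simp [← this]

theorem dihedral {T : Type*} [Finite T] (F G : Equiv.Perm T) (hF : F * F = 1) (hG : G * G = 1)
    (s : Setoid T) (hs : s = Relation.EqvGen.setoid fun x y => y = F x ∨ y = G x)
    (hd : ∀ x, ¬ (F x = x ∧ G x = x)) (x : T) (hx : G x = x) :
    ∃! y, y ≠ x ∧ (F y = y ∨ G y = y) ∧ s y x := by
  set h := F * G with hh
  have hFF : ∀ z, F (F z) = z := fun z => by rw [← Equiv.Perm.mul_apply, hF]; rfl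
  have hGG : ∀ z, G (G z) = z := fun z => by rw [← Equiv.Perm.mul_apply, hG]; rfl
  have hFi : F⁻¹ = F := inv_eq_of_mul_eq_one_left hF
  have hGi : G⁻¹ = G := inv_eq_of_mul_eq_one_left hG
  have hinv : h⁻¹ = G * F := by rw [hh, mul_inv_rev, hFi, hGi]
  have hconj : ∀ i : ℤ, G * h ^ i = h ^ (-i) * G := by
    intro i
    have h1 : G * h * G⁻¹ = h⁻¹ := by rw [hinv, hh, hGi, mul_assoc, mul_assoc, hG, mul_one]
    have h2 : (G * h * G⁻¹) ^ i = G * h ^ i * G⁻¹ := conj_zpow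
    rw [h1] at h2
    rw [zpow_neg, ← inv_zpow, h2]
    simp
  have hGh : ∀ i : ℤ, G ((h ^ i) x) = (h ^ (-i)) x := by
    intro i
    rw [← Equiv.Perm.mul_apply, hconj, Equiv.Perm.mul_apply, hx]
  have hFh : ∀ i : ℤ, F ((h ^ i) x) = (h ^ (1 - i)) x := by
    intro i
    have : F = h * G := by rw [hh, mul_assoc, hG, mul_one]
    rw [this, Equiv.Perm.mul_apply, hGh, ← Equiv.Perm.mul_apply, ← zpow_one_add, sub_eq_add_neg]
  have orb : ∀ y, s y x → ∃ i : ℤ, y = (h ^ i) x := by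
    have aux : ∀ y z, s y z → ((∃ i : ℤ, y = (h ^ i) x) ↔ ∃ i : ℤ, z = (h ^ i) x) := by
      intro y z hyz
      rw [hs] at hyz
      induction hyz with
      | rel y z h' =>
        rcases h' with rfl | rfl
        · constructor
          · rintro ⟨i, rfl⟩; exact ⟨_, hFh i⟩
          · rintro ⟨i, hi⟩
            refine ⟨1 - i, ?_⟩
            rw [← hFh, ← hi, hFF]
        · constructor
          · rintro ⟨i, rfl⟩; exact ⟨_, hGh i⟩
          · rintro ⟨i, hi⟩
            refine ⟨-i, ?_⟩
            rw [← hGh, ← hi, hGG]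
      | refl => rfl
      | symm _ _ _ ih => exact ih.symm
      | trans _ _ _ _ _ h1 h2 => exact h1.trans h2
    intro y hy
    exact (aux y x hy).2 ⟨0, rfl⟩
  have sF : ∀ y, s y (F y) := fun y => by rw [hs]; exact .rel _ _ (.inl rfl)
  have sG : ∀ y, s y (G y) := fun y => by rw [hs]; exact .rel _ _ (.inr rfl)
  have sh : ∀ y, s y (h y) := fun y => Setoid.trans' _ (sG y) (sF (G y))
  have shn : ∀ (n : ℕ) y, s ((h ^ n) y) y := by
    intro n
    induction n with
    | zero => intro y; exact Setoid.refl' _ _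
    | succ n ih =>
      intro y
      rw [pow_succ, Equiv.Perm.mul_apply]
      exact Setoid.trans' _ (ih _) (Setoid.symm' _ (sh y))
  -- the period of `x`
  set m := Function.minimalPeriod h x with hm
  have hmpos : 0 < m := by
    apply Function.minimalPeriod_pos_of_mem_periodicPts
    exact h.injective.mem_periodicPts x
  have per : ∀ i : ℤ, (h ^ i) x = x ↔ (m : ℤ) ∣ i := by
    intro i
    have := MulAction.zpow_smul_eq_iff_minimalPeriod_dvd (a := h) (b := x) (n := i)
    simpa [Equiv.Perm.smul_def] using this
  have per2 : ∀ i j : ℤ, (h ^ i) x = (h ^ j) x ↔ (m : ℤ) ∣ i - j := by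
    intro i j
    rw [← per, sub_eq_neg_add, zpow_add, Equiv.Perm.mul_apply, zpow_neg, Equiv.Perm.inv_eq_iff_eq]
    
  have fixG : ∀ i : ℤ, G ((h ^ i) x) = (h ^ i) x ↔ (m : ℤ) ∣ 2 * i := by
    intro i
    rw [hGh, eq_comm, per2]; ring_nf
  have fixF : ∀ i : ℤ, F ((h ^ i) x) = (h ^ i) x ↔ (m : ℤ) ∣ 2 * i - 1 := by
    intro i
    rw [hFh, eq_comm, per2]; ring_nf
  have xF : F x ≠ x := fun h => hd x ⟨h, hx⟩
  rcases Nat.even_or_odd' m with ⟨c, hc | hc⟩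
  · refine ⟨(h ^ (c : ℤ)) x, ⟨?_, .inr ((fixG _).2 ⟨1, by rw [hc]; push_cast; ring⟩), ?_⟩, ?_⟩
    · rw [Ne, per]
      rintro ⟨t, ht⟩
      rw [hc] at ht
      push_cast at ht
      have hc0 : (c : ℤ) > 0 := by omega
      have : (c : ℤ) * (2 * t - 1) = 0 := by linarith
      rcases mul_eq_zero.1 this with h | h <;> omega
    · exact_mod_cast shn c x
    · rintro y ⟨hyx, hy, hyr⟩
      obtain ⟨i, rfl⟩ := orb y hyr
      rw [fixF, fixG] at hy
      rw [per2]
      rw [Ne, per] at hyx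
      rcases hy with ⟨t, ht⟩ | ⟨t, ht⟩
      · rw [hc] at ht; push_cast at ht
        have : 2 * (i - c * t) = 1 := by linarith
        omega
      · rw [hc] at ht ⊢; push_cast at ht ⊢
        have h3 : i = c * t := by linarith
        rcases Int.even_or_odd' t with ⟨u, hu | hu⟩
        · exact absurd ⟨u, by rw [hc, h3, hu]; push_cast; ring⟩ hyx
        · exact ⟨u, by rw [h3, hu]; ring⟩
  · refine ⟨(h ^ ((c + 1 : ℕ) : ℤ)) x,
      ⟨?_, .inl ((fixF _).2 ⟨1, by rw [hc]; push_cast; ring⟩), ?_⟩, ?_⟩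
    · intro h'
      apply xF
      have := (fixF ((c + 1 : ℕ) : ℤ)).2 ⟨1, by rw [hc]; push_cast; ring⟩
      rwa [h'] at this
    · exact_mod_cast shn (c + 1) x
    · rintro y ⟨hyx, hy, hyr⟩
      obtain ⟨i, rfl⟩ := orb y hyr
      rw [fixF, fixG] at hy
      rw [per2]
      rw [Ne, per] at hyx
      have hcop : IsCoprime (m : ℤ) 2 := ⟨1, -c, by rw [hc]; push_cast; ring⟩
      rcases hy with hy | hy
      · apply hcop.dvd_of_dvd_mul_left
        have : 2 * (i - ((c + 1 : ℕ) : ℤ)) = (2 * i - 1) - m := by rw [hc]; push_cast; ring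
        rw [this]
        exact dvd_sub hy dvd_rfl
      · exact absurd (hcop.dvd_of_dvd_mul_left hy) hyx

theorem IsMatching.partner {Y : Type*} {p : Setoid Y} (hp : IsMatching p) :
    ∃ f : Y → Y, Function.Involutive f ∧ (∀ x, f x ≠ x) ∧ ∀ x y, p y x ↔ y = x ∨ y = f x := by
  choose f hf hu using hp
  refine ⟨f, fun x => ?_, fun x => (hf x).1, fun x y => ⟨fun h => ?_, ?_⟩⟩
  · exact (hu (f x) x ⟨(hf x).1.symm, Setoid.symm' _ (hf x).2⟩).symm
  · by_cases hyx : y = x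
    · exact .inl hyx
    · exact .inr (hu x y ⟨hyx, h⟩)
  · rintro (rfl | rfl)
    · exact Setoid.refl' _ _
    · exact (hf x).2

theorem comp_isMatching_inl [Finite X] {p q : Setoid (X ⊕ X)} (hp : IsMatching p)
    (hq : IsMatching q) (a : X) : ∃! y, y ≠ .inl a ∧ comp p q y (.inl a) := by
  obtain ⟨f, hf1, hf2, hf3⟩ := hp.partner
  obtain ⟨g, hg1, hg2, hg3⟩ := hq.partner
  let F : X ⊕ X ⊕ X → X ⊕ X ⊕ X
    | .inl a => topMid (f (.inl a))
    | .inr (.inl a) => topMid (f (.inr a))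
    | .inr (.inr a) => .inr (.inr a)
  let G : X ⊕ X ⊕ X → X ⊕ X ⊕ X
    | .inl a => .inl a
    | .inr a => .inr (g a)
  have hFt : ∀ a, F (topMid a) = topMid (f a) := by rintro (a | a) <;> rfl
  have hF : Function.Involutive F := by
    rintro (x | x | x)
    · change F (topMid _) = _
      rw [hFt, hf1]; rfl
    · change F (topMid _) = _
      rw [hFt, hf1]; rfl
    · rfl
  have hG : Function.Involutive G := by
    rintro (x | x)
    · rfl
    · change Sum.inr (g (g x)) = _
      rw [hg1]
  have htm : Function.Injective (topMid : X ⊕ X → _) := by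
    exact Sum.map_injective.2 ⟨Function.injective_id, Sum.inl_injective⟩
  have hFfix : ∀ x, F x = x ↔ ∃ a, x = .inr (.inr a) := by
    rintro (x | x | x)
    · simp only [reduceCtorEq, exists_false, iff_false]
      exact fun h => hf2 (.inl x) (htm h)
    · simp only [Sum.inr.injEq, reduceCtorEq, exists_false, iff_false]
      exact fun h => hf2 (.inr x) (htm h)
    · exact ⟨fun _ => ⟨x, rfl⟩, fun _ => rfl⟩
  have hGfix : ∀ x, G x = x ↔ ∃ a, x = .inl a := by
    rintro (x | x)
    · exact ⟨fun _ => ⟨x, rfl⟩, fun _ => rfl⟩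
    · simp only [reduceCtorEq, exists_false, iff_false]
      exact fun h => hg2 x (Sum.inr_injective h)
  have hs : stack p q = Relation.EqvGen.setoid fun x y => y = F x ∨ y = G x := by
    have hst : ∀ x y, (y = F x ∨ y = G x) → stack p q x y := by
      rintro x y (rfl | rfl)
      · rcases x with x | x | x
        · exact Setoid.symm' _ (stack_upper ((hf3 _ _).2 (.inr rfl)))
        · exact Setoid.symm' _ (stack_upper (b := .inr x) ((hf3 _ _).2 (.inr rfl)))
        · exact Setoid.refl' _ _
      · rcases x with x | x
        · exact Setoid.refl' _ _
        · exact Setoid.symm' _ (stack_lower ((hg3 _ _).2 (.inr rfl)))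
    apply le_antisymm
    · intro x y h
      refine stack_ind (Relation.EqvGen.setoid fun x y => y = F x ∨ y = G x) ?_ ?_ h
      · intro a b h
        rcases (hf3 _ _).1 h with rfl | rfl
        · exact Setoid.refl' _ _
        · exact Setoid.symm' _ (.rel _ _ (.inl (hFt b).symm))
      · intro a b h
        rcases (hg3 _ _).1 h with rfl | rfl
        · exact Setoid.refl' _ _
        · exact Setoid.symm' _ (.rel _ _ (.inr rfl))
    · intro x y h
      induction h with
      | rel x y h => exact hst _ _ h
      | refl x => exact Setoid.refl' _ _
      | symm x y _ ih => exact Setoid.symm' _ ih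
      | trans x y z _ _ h1 h2 => exact Setoid.trans' _ h1 h2
  obtain ⟨y, ⟨hy1, hy2, hy3⟩, hyu⟩ := dihedral hF.toPerm hG.toPerm
    (Equiv.ext hF) (Equiv.ext hG) (stack p q) hs
    (fun x h => by
      obtain ⟨a, rfl⟩ := (hFfix x).1 h.1
      obtain ⟨b, hb⟩ := (hGfix (.inr (.inr a))).1 h.2
      exact absurd hb (by simp))
    (.inl a) rfl
  have htb : Function.Injective (topBot : X ⊕ X → _) := by
    exact Sum.map_injective.2 ⟨Function.injective_id, Sum.inr_injective⟩
  obtain ⟨z, rfl⟩ : ∃ z, y = topBot z := by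
    rcases hy2 with h | h
    · obtain ⟨b, rfl⟩ := (hFfix y).1 h
      exact ⟨.inr b, rfl⟩
    · obtain ⟨b, rfl⟩ := (hGfix y).1 h
      exact ⟨.inl b, rfl⟩
  refine ⟨z, ⟨fun h => hy1 (by rw [h]; rfl), hy3⟩, ?_⟩
  rintro w ⟨hw1, hw2⟩
  apply htb
  refine hyu _ ⟨fun h => hw1 (htb h), ?_, hw2⟩
  rcases w with w | w
  · exact .inr rfl
  · exact .inl rfl

theorem comp_isMatching [Finite X] {p q : Setoid (X ⊕ X)} (hp : IsMatching p)
    (hq : IsMatching q) : IsMatching (comp p q) := by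
  rintro (a | a)
  · exact comp_isMatching_inl hp hq a
  · obtain ⟨y, ⟨h1, h2⟩, h3⟩ := comp_isMatching_inl (flip_isMatching hq) (flip_isMatching hp) a
    rw [comp_flip] at h2 h3
    refine ⟨y.swap, ⟨fun h => h1 ?_, h2⟩, ?_⟩
    · rw [← Sum.swap_swap y, h]; rfl
    · rintro z ⟨h4, h5⟩
      have hz1 : z.swap ≠ .inl a := fun h => h4 (by rw [← Sum.swap_swap z, h]; rfl)
      have hz2 : flip (comp p q) z.swap (.inl a) := by
        change comp p q z.swap.swap (.inr a)
        rwa [Sum.swap_swap]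
      rw [← h3 z.swap ⟨hz1, hz2⟩, Sum.swap_swap]

theorem comp_symm {p q : Setoid (X ⊕ X)} (σ : X → X)
    (hp : ∀ a b, p a b → p (a.map σ σ) (b.map σ σ))
    (hq : ∀ a b, q a b → q (a.map σ σ) (b.map σ σ)) (a b : X ⊕ X) (h : comp p q a b) :
    comp p q (a.map σ σ) (b.map σ σ) := by
  have key : ∀ x y, stack p q x y →
      stack p q (x.map σ (Sum.map σ σ)) (y.map σ (Sum.map σ σ)) := by
    intro x y h
    refine stack_ind ((stack p q).comap (Sum.map σ (Sum.map σ σ))) ?_ ?_ h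
    · intro a b h
      have := stack_upper (q := q) (hp a b h)
      rcases a with a | a <;> rcases b with b | b <;> exact this
    · intro a b h
      exact stack_lower (hq a b h)
  have := key _ _ h
  rcases a with a | a <;> rcases b with b | b <;> exact this

end Stack

/-! ### Brauer diagrams and the Brauer algebra -/

/-- A Brauer diagram with `N` northern nodes `Sum.inl i` and `N` southern nodes `Sum.inr i`: a
partition of the `2 * N` nodes into pairs. -/
@[ext]
structure BrauerDiagram (N : ℕ) where
  rel : Setoid (Fin N ⊕ Fin N)
  isMatching : IsMatching rel

namespace BrauerDiagram

variable {N : ℕ}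

/-- The diagram obtained by stacking `d` on top of `d'` and dropping the closed loops. -/
def comp (d d' : BrauerDiagram N) : BrauerDiagram N :=
  ⟨BrauerC.comp d.rel d'.rel, comp_isMatching d.isMatching d'.isMatching⟩

/-- The number of closed loops that appear when `d` is stacked on top of `d'`. -/
def loops (d d' : BrauerDiagram N) : ℕ := BrauerC.loops d.rel d'.rel

/-- The diagram with `N` vertical lines. -/
def id (N : ℕ) : BrauerDiagram N := ⟨idRel, idRel_isMatching⟩

/-- Reflection in the horizontal axis. -/
def flip (d : BrauerDiagram N) : BrauerDiagram N :=
  ⟨BrauerC.flip d.rel, flip_isMatching d.isMatching⟩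

/-- The diagram is fixed by the reflection `σ` in the vertical axis. -/
def IsSymmetric (d : BrauerDiagram N) : Prop :=
  ∀ x y, d.rel x y → d.rel (x.map Fin.rev Fin.rev) (y.map Fin.rev Fin.rev)

theorem IsSymmetric.comp {d d' : BrauerDiagram N} (h : d.IsSymmetric) (h' : d'.IsSymmetric) :
    (d.comp d').IsSymmetric := comp_symm Fin.rev h h'

theorem IsSymmetric.id (N : ℕ) : (BrauerDiagram.id N).IsSymmetric := by
  rintro (x | x) (y | y) h <;> exact congrArg Fin.rev h

theorem IsSymmetric.flip {d : BrauerDiagram N} (h : d.IsSymmetric) : d.flip.IsSymmetric := by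
  rintro (x | x) (y | y) h' <;> exact h _ _ h'

end BrauerDiagram

/-- The (type A) Brauer algebra on `N` strands over `R` with loop parameter `δ`: the free
`R`-module on the Brauer diagrams. -/
def BrauerAlgebra (R : Type*) [CommRing R] (_δ : R) (N : ℕ) : Type _ := BrauerDiagram N →₀ R

namespace BrauerAlgebra

variable {R : Type*} [CommRing R] {δ : R} {N : ℕ}

instance : AddCommGroup (BrauerAlgebra R δ N) := inferInstanceAs (AddCommGroup (_ →₀ R))
instance : Module R (BrauerAlgebra R δ N) := inferInstanceAs (Module R (_ →₀ R))

/-- A diagram as an element of the Brauer algebra. -/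
def diag (d : BrauerDiagram N) : BrauerAlgebra R δ N := Finsupp.single d (1 : R)

/-- The product of two diagrams is `δ ^ (number of closed loops)` times their composite, the first
factor being on top; it is extended bilinearly. -/
def mulLin : BrauerAlgebra R δ N →ₗ[R] BrauerAlgebra R δ N →ₗ[R] BrauerAlgebra R δ N :=
  Finsupp.linearCombination R fun d => Finsupp.linearCombination R fun d' =>
    δ ^ d.loops d' • (diag (d.comp d') : BrauerAlgebra R δ N)

theorem mulLin_diag (d d' : BrauerDiagram N) :
    mulLin (diag d : BrauerAlgebra R δ N) (diag d') = δ ^ d.loops d' • diag (d.comp d') := by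
  unfold mulLin
  have h1 := Finsupp.linearCombination_single (R := R) (M := BrauerAlgebra R δ N →ₗ[R] BrauerAlgebra R δ N)
    (v := fun d => Finsupp.linearCombination R fun d' =>
      δ ^ d.loops d' • (diag (d.comp d') : BrauerAlgebra R δ N)) 1 d
  have h2 := Finsupp.linearCombination_single (R := R) (M := BrauerAlgebra R δ N)
    (v := fun d' => δ ^ d.loops d' • (diag (d.comp d') : BrauerAlgebra R δ N)) 1 d'
  exact (congrArg (fun f => f (diag d')) (h1.trans (one_smul R _))).trans (h2.trans (one_smul R _))

theorem lin_ext {M : Type*} [AddCommGroup M] [Module R M] {f g : BrauerAlgebra R δ N →ₗ[R] M}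
    (h : ∀ d, f (diag d) = g (diag d)) : f = g :=
  Finsupp.lhom_ext' fun d => LinearMap.ext_ring (h d)

/-- Reflection in the horizontal axis, extended linearly. -/
def flipLin (R : Type*) [CommRing R] (δ : R) (N : ℕ) :
    BrauerAlgebra R δ N →ₗ[R] BrauerAlgebra R δ N :=
  Finsupp.linearCombination R fun d => (diag d.flip : BrauerAlgebra R δ N)

theorem flipLin_diag (d : BrauerDiagram N) :
    flipLin R δ N (diag d) = diag d.flip := by
  unfold flipLin
  have h := Finsupp.linearCombination_single (R := R) (M := BrauerAlgebra R δ N)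
    (v := fun d => (diag d.flip : BrauerAlgebra R δ N)) 1 d
  exact h.trans (one_smul R _)

theorem induction {p : BrauerAlgebra R δ N → Prop} (zero : p 0)
    (add : ∀ x y, p x → p y → p (x + y)) (smul : ∀ (r : R) x, p x → p (r • x))
    (diag : ∀ d, p (diag d)) (x : BrauerAlgebra R δ N) : p x := by
  refine Finsupp.induction_linear (motive := p) x zero add fun d r => ?_
  have h := smul r _ (diag d)
  have h' : r • (BrauerAlgebra.diag d : BrauerAlgebra R δ N) = Finsupp.single d r :=
    (Finsupp.smul_single r d (1 : R)).trans (by rw [smul_eq_mul, mul_one])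
  rwa [h'] at h

instance : Mul (BrauerAlgebra R δ N) := ⟨fun x y => mulLin x y⟩
instance : One (BrauerAlgebra R δ N) := ⟨diag (BrauerDiagram.id N)⟩

theorem diag_mul_diag (d d' : BrauerDiagram N) :
    (diag d * diag d' : BrauerAlgebra R δ N) = δ ^ d.loops d' • diag (d.comp d') :=
  mulLin_diag d d'

theorem smul_mul' (r : R) (x y : BrauerAlgebra R δ N) : (r • x) * y = r • (x * y) := by
  change mulLin (r • x) y = r • mulLin x y
  simp

theorem mul_smul' (r : R) (x y : BrauerAlgebra R δ N) : x * (r • y) = r • (x * y) := by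
  change mulLin x (r • y) = r • mulLin x y
  simp

theorem mul_assoc' (x y z : BrauerAlgebra R δ N) : x * y * z = x * (y * z) := by
  let L : BrauerAlgebra R δ N →ₗ[R] BrauerAlgebra R δ N →ₗ[R] BrauerAlgebra R δ N →ₗ[R]
      BrauerAlgebra R δ N := (LinearMap.compr₂ mulLin mulLin)
  let L' : BrauerAlgebra R δ N →ₗ[R] BrauerAlgebra R δ N →ₗ[R] BrauerAlgebra R δ N →ₗ[R]
      BrauerAlgebra R δ N := LinearMap.lcomp R _ mulLin ∘ₗ LinearMap.llcomp R _ _ _ ∘ₗ mulLin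
  have key : L = L' := by
    refine lin_ext fun d => lin_ext fun d' => lin_ext fun d'' => ?_
    change (diag d * diag d' : BrauerAlgebra R δ N) * diag d'' = diag d * (diag d' * diag d'')
    simp only [diag_mul_diag, smul_mul', mul_smul', smul_smul, ← pow_add]
    have h1 : (d.comp d').comp d'' = d.comp (d'.comp d'') :=
      BrauerDiagram.ext (comp_assoc _ _ _)
    have h2 : d.loops d' + (d.comp d').loops d'' = d'.loops d'' + d.loops (d'.comp d'') :=
      loops_assoc _ _ _
    rw [h1, h2]
  exact congrArg (fun f => f x y z) key

theorem one_mul' (x : BrauerAlgebra R δ N) : 1 * x = x := by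
  have key : mulLin (1 : BrauerAlgebra R δ N) = LinearMap.id := by
    refine lin_ext fun d => ?_
    change (diag (BrauerDiagram.id N) * diag d : BrauerAlgebra R δ N) = diag d
    rw [diag_mul_diag]
    have h1 : (BrauerDiagram.id N).comp d = d := BrauerDiagram.ext (id_comp _)
    have h2 : (BrauerDiagram.id N).loops d = 0 := id_loops _
    rw [h1, h2, pow_zero, one_smul]
  exact congrArg (fun f => f x) key

theorem mul_one' (x : BrauerAlgebra R δ N) : x * 1 = x := by
  have key : mulLin.flip (1 : BrauerAlgebra R δ N) = LinearMap.id := by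
    refine lin_ext fun d => ?_
    change (diag d * diag (BrauerDiagram.id N) : BrauerAlgebra R δ N) = diag d
    rw [diag_mul_diag]
    have h1 : d.comp (BrauerDiagram.id N) = d := BrauerDiagram.ext (comp_id _)
    have h2 : d.loops (BrauerDiagram.id N) = 0 := loops_id _
    rw [h1, h2, pow_zero, one_smul]
  exact congrArg (fun f => f x) key

instance : Ring (BrauerAlgebra R δ N) where
  __ := (inferInstance : AddCommGroup (BrauerAlgebra R δ N))
  mul := (· * ·)
  one := 1
  mul_assoc := mul_assoc'
  one_mul := one_mul'
  mul_one := mul_one'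
  left_distrib x y z := (mulLin x).map_add y z
  right_distrib x y z := mulLin.map_add₂ x y z
  zero_mul x := mulLin.map_zero₂ x
  mul_zero x := (mulLin x).map_zero

instance : Algebra R (BrauerAlgebra R δ N) := Algebra.ofModule smul_mul' mul_smul'

end BrauerAlgebra

/-! ### Cellular algebras -/

/-- An `R`-linear anti-automorphism `i` of `A` with `i ^ 2 = id`. -/
structure AntiInvolution (R A : Type*) [CommRing R] [Ring A] [Algebra R A] where
  toLin : A →ₗ[R] A
  map_mul : ∀ a b, toLin (a * b) = toLin b * toLin a
  invol : ∀ a, toLin (toLin a) = a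

namespace AntiInvolution

variable {R A : Type*} [CommRing R] [Ring A] [Algebra R A]

/-- The anti-involution induced on the quotient by an `i`-stable two-sided ideal. -/
def quotient (i : AntiInvolution R A) (I : Ideal A) [I.IsTwoSided]
    (hI : ∀ x ∈ I, i.toLin x ∈ I) : AntiInvolution R (A ⧸ I) where
  toLin :=
    { toFun := QuotientAddGroup.map _ _ i.toLin.toAddMonoidHom hI
      map_add' := _root_.map_add _
      map_smul' := by
        intro r x
        obtain ⟨x, rfl⟩ := Ideal.Quotient.mk_surjective x
        exact congrArg (Ideal.Quotient.mkₐ R I) (i.toLin.map_smul r x) }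
  map_mul := by
    intro a b
    obtain ⟨a, rfl⟩ := Ideal.Quotient.mk_surjective a
    obtain ⟨b, rfl⟩ := Ideal.Quotient.mk_surjective b
    exact congrArg (Ideal.Quotient.mkₐ R I) (i.map_mul a b)
  invol := by
    intro a
    obtain ⟨a, rfl⟩ := Ideal.Quotient.mk_surjective a
    exact congrArg (Ideal.Quotient.mkₐ R I) (i.invol a)

theorem quotient_mk (i : AntiInvolution R A) (I : Ideal A) [I.IsTwoSided]
    (hI : ∀ x ∈ I, i.toLin x ∈ I) (x : A) :
    (i.quotient I hI).toLin (Ideal.Quotient.mkₐ R I x) = Ideal.Quotient.mkₐ R I (i.toLin x) := rfl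

end AntiInvolution

/-- `J` is a cell ideal of `A` with respect to `i`, with cell module the left ideal `Δ ⊆ J`: there
is an isomorphism of `A`-bimodules `J ≅ Δ ⊗ i(Δ)` (written here from right to left) that carries
`i` to `x ⊗ y ↦ i(y) ⊗ i(x)`. -/
structure IsCellIdeal {R A : Type*} [CommRing R] [Ring A] [Algebra R A] (i : AntiInvolution R A)
    (J Δ : Submodule R A) : Prop where
  mul_left : ∀ a, ∀ x ∈ J, a * x ∈ J
  mul_right : ∀ a, ∀ x ∈ J, x * a ∈ J
  map_inv : J.map i.toLin = J
  le : Δ ≤ J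
  left_ideal : ∀ a, ∀ x ∈ Δ, a * x ∈ Δ
  finite : Module.Finite R Δ
  free : Module.Free R Δ
  exists_iso : ∃ β : (Δ ⊗[R] Δ.map i.toLin) ≃ₗ[R] J,
    (∀ (a : A) (x x' : Δ) (y : Δ.map i.toLin), (x' : A) = a * x →
      (β (x' ⊗ₜ y) : A) = a * β (x ⊗ₜ y)) ∧
    (∀ (a : A) (x : Δ) (y y' : Δ.map i.toLin), (y' : A) = y * a →
      (β (x ⊗ₜ y') : A) = β (x ⊗ₜ y) * a) ∧
    (∀ (x x' : Δ) (y y' : Δ.map i.toLin), (x' : A) = i.toLin y → (y' : A) = i.toLin x →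
      i.toLin (β (x ⊗ₜ y)) = β (x' ⊗ₜ y'))

/-- A decomposition `A = ⨁ J'_l` of `R`-modules, `l` running through a linear order, with
`i(J'_l) = J'_l` and such that every partial sum `⨁_{m ≤ l} J'_m` is a two-sided ideal. -/
structure IdealChain {R A : Type*} [CommRing R] [Ring A] [Algebra R A] (i : AntiInvolution R A)
    (Λ : Type*) [LinearOrder Λ] where
  summand : Λ → Submodule R A
  internal : DirectSum.IsInternal summand
  map_inv : ∀ l, (summand l).map i.toLin = summand l
  mul_left : ∀ l, ∀ a, ∀ x ∈ ⨆ m, ⨆ _ : m ≤ l, summand m, a * x ∈ ⨆ m, ⨆ _ : m ≤ l, summand m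
  mul_right : ∀ l, ∀ a, ∀ x ∈ ⨆ m, ⨆ _ : m ≤ l, summand m, x * a ∈ ⨆ m, ⨆ _ : m ≤ l, summand m

namespace IdealChain

variable {R A : Type*} [CommRing R] [Ring A] [Algebra R A] {i : AntiInvolution R A}
  {Λ : Type*} [LinearOrder Λ] (C : IdealChain i Λ)

/-- `J_l = ⨁_{m ≤ l} J'_m`. -/
def upTo (l : Λ) : Submodule R A := ⨆ m, ⨆ _ : m ≤ l, C.summand m

/-- `⨁_{m < l} J'_m`, the predecessor of `J_l` in the chain. -/
def belowSub (l : Λ) : Submodule R A := ⨆ m, ⨆ _ : m < l, C.summand m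

theorem belowSub_eq (l : Λ) : C.belowSub l = ⨆ m, ⨆ _ : m < l, C.upTo m := by
  apply le_antisymm
  · refine iSup₂_le fun m hm => ?_
    exact le_iSup₂_of_le m hm (le_iSup₂_of_le m le_rfl le_rfl)
  · refine iSup₂_le fun m hm => iSup₂_le fun k hk => ?_
    exact le_iSup₂_of_le k (hk.trans_lt hm) le_rfl

theorem belowSub_map {l : Λ} (f : A →ₗ[R] A) (hf : ∀ m, ∀ x ∈ C.upTo m, f x ∈ C.upTo m)
    {x : A} (hx : x ∈ C.belowSub l) : f x ∈ C.belowSub l := by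
  rw [belowSub_eq] at hx ⊢
  have : (⨆ m, ⨆ _ : m < l, C.upTo m) ≤ (⨆ m, ⨆ _ : m < l, C.upTo m).comap f := by
    refine iSup₂_le fun m hm y hy => ?_
    exact (le_iSup₂_of_le (f := fun m (_ : m < l) => C.upTo m) m hm le_rfl) (hf m y hy)
  exact this hx

/-- `belowSub l` as a (two-sided) ideal. -/
def below (l : Λ) : Ideal A where
  carrier := C.belowSub l
  add_mem' := (C.belowSub l).add_mem
  zero_mem' := (C.belowSub l).zero_mem
  smul_mem' a _ hx := C.belowSub_map (LinearMap.mulLeft R a) (fun m => C.mul_left m a) hx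

instance (l : Λ) : (C.below l).IsTwoSided where
  mul_mem_of_left a hx :=
    C.belowSub_map (LinearMap.mulRight R a) (fun m => C.mul_right m a) hx

theorem below_inv (l : Λ) : ∀ x ∈ C.below l, i.toLin x ∈ C.below l := by
  intro x hx
  refine C.belowSub_map i.toLin ?_ hx
  intro m
  have : C.upTo m ≤ (C.upTo m).comap i.toLin := by
    refine iSup₂_le fun k hk y hy => ?_
    refine (le_iSup₂_of_le (f := fun k (_ : k ≤ m) => C.summand k) k hk le_rfl) ?_
    rw [← C.map_inv k]
    exact ⟨y, hy, rfl⟩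
  exact this

/-- The projection of `A` onto the quotient by `⨁_{m < l} J'_m`. -/
def proj (l : Λ) : A →ₗ[R] A ⧸ C.below l := (Ideal.Quotient.mkₐ R (C.below l)).toLinearMap

end IdealChain

/-- A cell chain of `A` with respect to `i`: a chain as above in which every `J_l / J_{<l}` is a
cell ideal of `A / J_{<l}`, together with its cell modules `cell l`, which are left ideals of
`A / J_{<l}` and thereby left `A`-modules. -/
structure CellChain {R A : Type*} [CommRing R] [Ring A] [Algebra R A] (i : AntiInvolution R A)
    (Λ : Type*) [LinearOrder Λ] extends IdealChain i Λ where
  cell : ∀ l, Submodule R (A ⧸ toIdealChain.below l)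
  isCellIdeal : ∀ l, IsCellIdeal (i.quotient (toIdealChain.below l) (toIdealChain.below_inv l))
    ((toIdealChain.upTo l).map (toIdealChain.proj l)) (cell l)

/-! ### Hyperoctahedral groups -/

/-- The hyperoctahedral group `H_m` as the group of the permutations of `2 * m` letters that
commute with the reflection `i ↦ 2 * m + 1 - i` (letters being numbered from `1`). -/
abbrev Hyperoctahedral (m : ℕ) : Subgroup (Equiv.Perm (Fin (2 * m))) :=
  Subgroup.centralizer {Fin.revPerm}

/-- The anti-involution `g ↦ g⁻¹` of a group algebra. -/
def groupInv (R G : Type*) [CommRing R] [Group G] : AntiInvolution R (MonoidAlgebra R G) where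
  toLin := MonoidAlgebra.mapDomainLinearMap R R fun g : G => g⁻¹
  map_mul := by
    intro a b
    induction a using MonoidAlgebra.induction_linear with
    | zero => simp
    | add a a' h h' => simp only [add_mul, mul_add, map_add, h, h']
    | single g r =>
      induction b using MonoidAlgebra.induction_linear with
      | zero => simp
      | add b b' h h' => simp only [add_mul, mul_add, map_add, h, h']
      | single g' r' => simp [MonoidAlgebra.single_mul_single, mul_comm]
  invol := by
    intro a
    induction a using MonoidAlgebra.induction_linear with
    | zero => simp
    | add a a' h h' => simp only [map_add, h, h']
    | single g r => simp

/-! ### The Brauer algebra of type C -/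

/-- The Brauer algebra of type `C_n`: the subalgebra of the Brauer algebra on `2 * n` strands spanned
by the diagrams that are fixed by the reflection in the vertical axis. -/
def typeC (R : Type*) [CommRing R] (δ : R) (n : ℕ) : Subalgebra R (BrauerAlgebra R δ (2 * n)) :=
  (Submodule.span R {x | ∃ d : BrauerDiagram (2 * n), d.IsSymmetric ∧
    x = BrauerAlgebra.diag d}).toSubalgebra
    (Submodule.subset_span ⟨_, BrauerDiagram.IsSymmetric.id _, rfl⟩) <| by
      intro x y hx hy
      induction hx using Submodule.span_induction with
      | zero => rw [zero_mul]; exact Submodule.zero_mem _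
      | add a b _ _ ha hb => rw [add_mul]; exact Submodule.add_mem _ ha hb
      | smul r a _ ha => rw [smul_mul_assoc]; exact Submodule.smul_mem _ _ ha
      | mem a ha =>
        obtain ⟨d, hd, rfl⟩ := ha
        induction hy using Submodule.span_induction with
        | zero => rw [mul_zero]; exact Submodule.zero_mem _
        | add a b _ _ ha hb => rw [mul_add]; exact Submodule.add_mem _ ha hb
        | smul r a _ ha => rw [mul_smul_comm]; exact Submodule.smul_mem _ _ ha
        | mem b hb =>
          obtain ⟨d', hd', rfl⟩ := hb
          rw [BrauerAlgebra.diag_mul_diag]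
          exact Submodule.smul_mem _ _ (Submodule.subset_span ⟨_, hd.comp hd', rfl⟩)

theorem BrauerAlgebra.flipLin_mul {R : Type*} [CommRing R] {δ : R} {N : ℕ}
    (a b : BrauerAlgebra R δ N) : flipLin R δ N (a * b) = flipLin R δ N b * flipLin R δ N a := by
  induction a using BrauerAlgebra.induction with
  | zero => rw [zero_mul, map_zero, mul_zero]
  | add x y hx hy => rw [add_mul, map_add, map_add, mul_add, hx, hy]
  | smul r x hx => rw [smul_mul', map_smul, map_smul, mul_smul', hx]
  | diag d =>
    induction b using BrauerAlgebra.induction with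
    | zero => rw [mul_zero, map_zero, zero_mul]
    | add x y hx hy => rw [mul_add, map_add, map_add, add_mul, hx, hy]
    | smul r x hx => rw [mul_smul', map_smul, map_smul, smul_mul', hx]
    | diag d' =>
      have h1 : d'.flip.comp d.flip = (d.comp d').flip := BrauerDiagram.ext (comp_flip _ _)
      have h2 : d'.flip.loops d.flip = d.loops d' := loops_flip _ _
      rw [diag_mul_diag, map_smul, flipLin_diag, flipLin_diag, flipLin_diag, diag_mul_diag, h1, h2]

theorem BrauerAlgebra.flipLin_flipLin {R : Type*} [CommRing R] {δ : R} {N : ℕ}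
    (a : BrauerAlgebra R δ N) : flipLin R δ N (flipLin R δ N a) = a := by
  induction a using BrauerAlgebra.induction with
  | zero => rw [map_zero, map_zero]
  | add x y hx hy => rw [map_add, map_add, hx, hy]
  | smul r x hx => rw [map_smul, map_smul, hx]
  | diag d =>
    have h1 : d.flip.flip = d := BrauerDiagram.ext (flip_flip _)
    rw [flipLin_diag, flipLin_diag, h1]

/-- The anti-involution of the Brauer algebra given by reflection in the horizontal axis. -/
def brauerFlip (R : Type*) [CommRing R] (δ : R) (N : ℕ) : AntiInvolution R (BrauerAlgebra R δ N) where
  toLin := BrauerAlgebra.flipLin R δ N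
  map_mul := BrauerAlgebra.flipLin_mul
  invol := BrauerAlgebra.flipLin_flipLin

/-- The anti-involution of the Brauer algebra of type `C_n` given by reflection in the horizontal
axis. -/
def typeCFlip (R : Type*) [CommRing R] (δ : R) (n : ℕ) : AntiInvolution R (typeC R δ n) where
  toLin := (brauerFlip R δ (2 * n)).toLin.restrict (p := (typeC R δ n).toSubmodule)
    (q := (typeC R δ n).toSubmodule) <| by
      intro x hx
      change x ∈ Submodule.span R _ at hx
      induction hx using Submodule.span_induction with
      | zero => rw [map_zero]; exact Submodule.zero_mem _
      | add a b _ _ ha hb => rw [map_add]; exact Submodule.add_mem _ ha hb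
      | smul r a _ ha => rw [map_smul]; exact Submodule.smul_mem _ _ ha
      | mem a ha =>
        obtain ⟨d, hd, rfl⟩ := ha
        exact Submodule.subset_span ⟨_, hd.flip, BrauerAlgebra.flipLin_diag d⟩
  map_mul a b := Subtype.ext ((brauerFlip R δ (2 * n)).map_mul a b)
  invol a := Subtype.ext ((brauerFlip R δ (2 * n)).invol a)

/-! ### Symmetric dangles -/

/-- A symmetric dangle on `2 * n` nodes with `k` arcs: a partition of the `2 * n` nodes into
`2 * n - 2 * k` one-element subsets and `k` two-element subsets that is invariant under the
reflection in the vertical axis. -/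
@[ext]
structure SymDangle (n k : ℕ) where
  rel : Setoid (Fin (2 * n))
  two : ∀ x y z, rel x y → rel x z → x = y ∨ x = z ∨ y = z
  symm : ∀ x y, rel x y → rel x.rev y.rev
  card : {x | ∀ y, rel x y → y = x}.ncard + 2 * k = 2 * n

namespace SymDangle

variable {n k : ℕ}

open Classical in
/-- The nodes that are not on an arc. -/
def freeNodes (e : SymDangle n k) : Finset (Fin (2 * n)) :=
  Finset.univ.filter fun x => ∀ y, e.rel x y → y = x

theorem mem_freeNodes (e : SymDangle n k) (x) : x ∈ e.freeNodes ↔ ∀ y, e.rel x y → y = x := by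
  simp [freeNodes]

theorem card_freeNodes (e : SymDangle n k) : e.freeNodes.card = 2 * (n - k) := by
  have h := e.card
  have h2 : {x | ∀ y, e.rel x y → y = x} = (e.freeNodes : Set (Fin (2 * n))) := by
    ext x; simp [mem_freeNodes]
  rw [h2, Set.ncard_coe_finset] at h
  omega

/-- The free nodes, numbered from left to right. -/
def free (e : SymDangle n k) : Fin (2 * (n - k)) ↪o Fin (2 * n) :=
  e.freeNodes.orderEmbOfFin e.card_freeNodes

theorem free_rev (e : SymDangle n k) (j : Fin (2 * (n - k))) : e.free j.rev = (e.free j).rev := by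
  have h : (fun j : Fin (2 * (n - k)) => (e.free j.rev).rev) = e.free := by
    apply Finset.orderEmbOfFin_unique
    · intro j
      rw [mem_freeNodes]
      intro y hy
      have h1 := e.symm _ _ hy
      rw [Fin.rev_rev] at h1
      have h2 := (e.mem_freeNodes _).1 (Finset.orderEmbOfFin_mem _ e.card_freeNodes j.rev) _ h1
      rw [← Fin.rev_rev y, h2]
      rfl
    · intro a b hab
      have : e.free b.rev < e.free a.rev := e.free.strictMono (Fin.rev_lt_rev.2 hab)
      exact Fin.rev_lt_rev.2 this
  have := congrFun h j
  rw [← this, Fin.rev_rev]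

theorem free_eq (e : SymDangle n k) {j y} (h : e.rel (e.free j) y) : y = e.free j :=
  (e.mem_freeNodes _).1 (Finset.orderEmbOfFin_mem _ e.card_freeNodes j) _ h

theorem free_or (e : SymDangle n k) (x) :
    (∃ j, e.free j = x) ∨ ∃ y, y ≠ x ∧ e.rel y x := by
  by_cases h : x ∈ e.freeNodes
  · left
    have : x ∈ Set.range (e.freeNodes.orderEmbOfFin e.card_freeNodes) := by
      rw [Finset.range_orderEmbOfFin]; exact h
    exact this
  · right
    rw [mem_freeNodes] at h
    push Not at h
    obtain ⟨y, hy, hne⟩ := h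
    exact ⟨y, hne, Setoid.symm' _ hy⟩

/-- The relation of being joined in the diagram with the arcs of `e` on top, those of `f` at the
bottom, and a line from the `j`-th free southern node to the `π j`-th free northern node. -/
def Glue (e f : SymDangle n k) (π : Equiv.Perm (Fin (2 * (n - k)))) :
    Fin (2 * n) ⊕ Fin (2 * n) → Fin (2 * n) ⊕ Fin (2 * n) → Prop
  | .inl x, .inl y => e.rel x y
  | .inr x, .inr y => f.rel x y
  | .inl x, .inr y => ∃ j, e.free (π j) = x ∧ f.free j = y
  | .inr y, .inl x => ∃ j, e.free (π j) = x ∧ f.free j = y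

/-- The partition of the nodes given by `Glue`. -/
def glueSetoid (e f : SymDangle n k) (π : Equiv.Perm (Fin (2 * (n - k)))) :
    Setoid (Fin (2 * n) ⊕ Fin (2 * n)) where
  r := Glue e f π
  iseqv :=
    { refl := by rintro (x | x) <;> exact Setoid.refl' _ _
      symm := by
        rintro (x | x) (y | y) h
        · exact Setoid.symm' _ h
        · exact h
        · exact h
        · exact Setoid.symm' _ h
      trans := by
        rintro (x | x) (y | y) (z | z) h h'
        · exact Setoid.trans' _ h h'
        · obtain ⟨j, rfl, rfl⟩ := h'
          exact ⟨j, (e.free_eq (Setoid.symm' _ h)).symm, rfl⟩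
        · obtain ⟨j, rfl, rfl⟩ := h
          obtain ⟨j', rfl, h2⟩ := h'
          rw [f.free.injective h2]
          exact Setoid.refl' e.rel _
        · obtain ⟨j, rfl, rfl⟩ := h
          exact ⟨j, rfl, (f.free_eq h').symm⟩
        · obtain ⟨j, rfl, rfl⟩ := h
          exact ⟨j, (e.free_eq h').symm, rfl⟩
        · obtain ⟨j, rfl, rfl⟩ := h
          obtain ⟨j', h2, rfl⟩ := h'
          rw [π.injective (e.free.injective h2)]
          exact Setoid.refl' f.rel _
        · obtain ⟨j, rfl, rfl⟩ := h'
          exact ⟨j, rfl, (f.free_eq (Setoid.symm' _ h)).symm⟩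
        · exact Setoid.trans' _ h h' }

/-- The Brauer diagram of the triple `(e, f, π)`. -/
def glue (e f : SymDangle n k) (π : Equiv.Perm (Fin (2 * (n - k)))) : BrauerDiagram (2 * n) where
  rel := glueSetoid e f π
  isMatching := by
    rintro (x | x)
    · rcases e.free_or x with ⟨j, rfl⟩ | ⟨y, hy, hyx⟩
      · refine ⟨.inr (f.free (π.symm j)), ⟨by simp, π.symm j, by simp, rfl⟩, ?_⟩
        rintro (z | z) ⟨h1, h2⟩
        · exact absurd (congrArg Sum.inl (e.free_eq (Setoid.symm' e.rel h2))) h1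
        · obtain ⟨j', h3, rfl⟩ := h2
          rw [← e.free.injective h3]; simp
      · refine ⟨.inl y, ⟨by simpa using hy, hyx⟩, ?_⟩
        rintro (z | z) ⟨h1, h2⟩
        · have := e.two x y z (Setoid.symm' _ hyx) (Setoid.symm' e.rel h2)
          rcases this with h | h | h
          · exact absurd h.symm hy
          · exact absurd (congrArg Sum.inl h.symm) h1
          · rw [h]
        · obtain ⟨j, rfl, rfl⟩ := h2
          exact absurd (e.free_eq (Setoid.symm' _ hyx)) hy
    · rcases f.free_or x with ⟨j, rfl⟩ | ⟨y, hy, hyx⟩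
      · refine ⟨.inl (e.free (π j)), ⟨by simp, j, rfl, rfl⟩, ?_⟩
        rintro (z | z) ⟨h1, h2⟩
        · obtain ⟨j', rfl, h3⟩ := h2
          rw [← f.free.injective h3]
        · exact absurd (congrArg Sum.inr (f.free_eq (Setoid.symm' f.rel h2))) h1
      · refine ⟨.inr y, ⟨by simpa using hy, hyx⟩, ?_⟩
        rintro (z | z) ⟨h1, h2⟩
        · obtain ⟨j, rfl, rfl⟩ := h2
          exact absurd (f.free_eq (Setoid.symm' _ hyx)) hy
        · have := f.two x y z (Setoid.symm' _ hyx) (Setoid.symm' f.rel h2)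
          rcases this with h | h | h
          · exact absurd h.symm hy
          · exact absurd (congrArg Sum.inr h.symm) h1
          · rw [h]

theorem glue_isSymmetric (e f : SymDangle n k) (π : Hyperoctahedral (n - k)) :
    (glue e f π.1).IsSymmetric := by
  have hπ : ∀ j, π.1 j.rev = (π.1 j).rev := by
    intro j
    have h := Subgroup.mem_centralizer_singleton_iff.1 π.2
    exact congrArg (fun g : Equiv.Perm _ => g j) h
  have aux : ∀ x y, (glue e f π.1).rel (.inl x) (.inr y) →
      (glue e f π.1).rel (.inl x.rev) (.inr y.rev) := by
    rintro x y ⟨j, rfl, rfl⟩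
    exact ⟨j.rev, by rw [hπ, free_rev], free_rev _ _⟩
  rintro (x | x) (y | y) h
  · exact e.symm _ _ h
  · exact aux _ _ h
  · exact Setoid.symm' _ (aux _ _ (Setoid.symm' _ h))
  · exact f.symm _ _ h

end SymDangle

/-- The free `R`-module on the symmetric dangles on `2 * n` nodes with `k` arcs. -/
abbrev DangleModule (R : Type*) [CommRing R] (n k : ℕ) : Type _ := SymDangle n k →₀ R

/-- The diagram of the triple `(e, f, π)` as an element of the Brauer algebra of type `C_n`. -/
def layerDiag (R : Type*) [CommRing R] (δ : R) (n k : ℕ) (e f : SymDangle n k)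
    (π : Hyperoctahedral (n - k)) : typeC R δ n :=
  ⟨BrauerAlgebra.diag (SymDangle.glue e f π.1),
    Submodule.subset_span ⟨_, SymDangle.glue_isSymmetric e f π, rfl⟩⟩

/-- The identification of `V ⊗ V ⊗ R[H_{n-k}]`, `V` being the module of symmetric dangles with `k`
arcs, with the span of the symmetric diagrams with exactly `k` northern arcs, written as a trilinear
map: `e ⊗ f ⊗ π` goes to the diagram of the triple `(e, f, π)`. -/
def layer (R : Type*) [CommRing R] (δ : R) (n k : ℕ) :
    DangleModule R n k →ₗ[R] DangleModule R n k →ₗ[R]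
      MonoidAlgebra R (Hyperoctahedral (n - k)) →ₗ[R] typeC R δ n :=
  Finsupp.linearCombination R fun e => Finsupp.linearCombination R fun f =>
    (Finsupp.linearCombination R fun π => layerDiag R δ n k e f π) ∘ₗ
      (MonoidAlgebra.coeffLinearEquiv R).toLinearMap

end BrauerC
end

/-!
The triples (northern dangle, southern dangle, permutation of the vertical lines) number the basis
of symmetric diagrams, so the span of the diagrams with `k` northern arcs is a module of matrices:
rows and columns are indexed by the symmetric dangles with `k` arcs, and the entries lie in the
group algebra of the hyperoctahedral group `H_{n-k}`. Reflection in the horizontal axis is the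
conjugate transpose. A product of diagrams has at least as many arcs as each factor, and modulo
diagrams with more arcs multiplication from the left is given by a matrix over the group algebra
that does not involve the southern dangle. These facts are recorded in the structure `MatrixLayers`.

The essential point is the last one (`SymDangle.diag_mul_glue`). Let `ε` be the diagram whose
northern and southern dangle is `e` and whose vertical lines do not cross. For every diagram `x`
with northern dangle `e`, the product `ε x` is `δ ^ l` times `x`, where `l` depends on `e` only. As
`δ` is invertible, associativity reduces the product `d x` to the product `d ε`. Either `d ε` has
more arcs than `e`, and then so has `d x`; or `d ε` again has southern dangle `e`, and then its
product with `x` is obtained by multiplying the permutations.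

The rest is linear algebra. If `J` is a cell ideal with cell module `Δ`, then the matrices with
entries in `J` form a cell ideal (`IsCellIdeal.inflate`): the cell module consists of the columns
`u` over `Δ` times the fixed row `v`, and the columns `u` and the rows `w` are combined to the
matrix with entries `u e ⊗ w f`. The factor `v` cancels because `v` has zero annihilator and `Δ` is
free. Applied in the successive quotients, this turns the cell chains of the group algebras into a
cell chain of the algebra of type `C_n` (`MatrixLayers.exists_cellChain`).
-/

noncomputable section

namespace BrauerC

/-! ### Composition of glued diagrams -/

/-- Perfect matchings are pairwise incomparable partitions. -/
theorem IsMatching.eq_of_le {Y : Type*} {p q : Setoid Y} (hp : IsMatching p) (hq : IsMatching q)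
    (h : ∀ x y, p x y → q x y) : p = q := by
  ext x y
  refine ⟨h x y, fun hxy => ?_⟩
  by_cases hyx : x = y
  · rw [hyx]
  obtain ⟨z, ⟨hz1, hz2⟩, -⟩ := hp y
  rw [(hq y).unique ⟨hyx, hxy⟩ ⟨hz1, h _ _ hz2⟩]
  exact hz2

namespace SymDangle

variable {n k : ℕ}

theorem glue_comp_glue (e' e f : SymDangle n k) (τ π : Equiv.Perm (Fin (2 * (n - k)))) :
    (glue e' e τ).comp (glue e f π) = glue e' f (τ * π) := by
  apply BrauerDiagram.ext
  symm
  -- both sides are perfect matchings, so it suffices to follow the lines of the right-hand side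
  apply (glue e' f (τ * π)).isMatching.eq_of_le ((glue e' e τ).comp (glue e f π)).isMatching
  have aux : ∀ x y, Glue e' f (τ * π) (.inl x) (.inr y) →
      BrauerC.comp (glue e' e τ).rel (glue e f π).rel (.inl x) (.inr y) := by
    rintro x y ⟨j, rfl, rfl⟩
    have h1 : stack (glue e' e τ).rel (glue e f π).rel (topMid (.inl (e'.free (τ (π j)))))
        (topMid (.inr (e.free (π j)))) := stack_upper ⟨π j, rfl, rfl⟩
    have h2 : stack (glue e' e τ).rel (glue e f π).rel (midBot (.inl (e.free (π j))))
        (midBot (.inr (f.free j))) := stack_lower ⟨j, rfl, rfl⟩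
    exact Setoid.trans' (stack _ _) h1 h2
  rintro (x | x) (y | y) h
  · exact stack_upper (a := .inl x) (b := .inl y) h
  · exact aux _ _ h
  · exact Setoid.symm' _ (aux _ _ h)
  · exact stack_lower (a := .inr x) (b := .inr y) h

/-- The closed loops that appear when two diagrams are stacked whose inner dangles are both `e`
are the arcs of `e`. -/
theorem loopClasses_glue (e' e f : SymDangle n k) (τ π : Equiv.Perm (Fin (2 * (n - k)))) :
    loopClasses (glue e' e τ).rel (glue e f π).rel =
      {C | ∃ x ∉ e.freeNodes, C = {z | ∃ y, e.rel y x ∧ z = .inr (.inl y)}} := by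
  classical
  -- the component of a node of the middle row that lies on an arc is the block of that node
  have key : ∀ x ∉ e.freeNodes, ∀ z, stack (glue e' e τ).rel (glue e f π).rel z (.inr (.inl x)) ↔
      ∃ y, e.rel y x ∧ z = .inr (.inl y) := by
    intro x hx z
    constructor
    · intro h
      -- `g` is constant on components: it sends the arcs of `e` in the middle row to their blocks
      -- and all other nodes to `none`
      let g : Fin (2 * n) ⊕ Fin (2 * n) ⊕ Fin (2 * n) → Option (Quotient e.rel)
        | .inl _ => none
        | .inr (.inl y) => if y ∈ e.freeNodes then none else some (Quotient.mk _ y)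
        | .inr (.inr _) => none
      have gfree : ∀ j, g (.inr (.inl (e.free j))) = none := fun j =>
        if_pos (Finset.orderEmbOfFin_mem _ e.card_freeNodes j)
      have grel : ∀ a b, e.rel a b → g (.inr (.inl a)) = g (.inr (.inl b)) := by
        intro a b hab
        by_cases ha : a ∈ e.freeNodes
        · rw [(e.mem_freeNodes a).1 ha b hab]
        · have hb : b ∉ e.freeNodes := fun hb =>
            ha (by rwa [(e.mem_freeNodes b).1 hb a (Setoid.symm' _ hab)])
          have hq : (Quotient.mk e.rel a) = Quotient.mk e.rel b := Quotient.sound hab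
          simp only [g, if_neg ha, if_neg hb, hq]
      have hg : g z = g (.inr (.inl x)) := by
        refine stack_ind (Setoid.ker g) ?_ ?_ h
        · rintro (a | a) (b | b) hab
          · rfl
          · obtain ⟨j, -, rfl⟩ := hab
            exact (gfree j).symm
          · obtain ⟨j, -, rfl⟩ := hab
            exact gfree j
          · exact grel a b hab
        · rintro (a | a) (b | b) hab
          · exact grel a b hab
          · obtain ⟨j, rfl, -⟩ := hab
            exact gfree _
          · obtain ⟨j, rfl, -⟩ := hab
            exact (gfree _).symm
          · rfl
      have hgx : g (.inr (.inl x)) = some (Quotient.mk _ x) := if_neg hx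
      rw [hgx] at hg
      rcases z with z | z | z
      · exact absurd hg (by simp [g])
      · by_cases hz : z ∈ e.freeNodes
        · exact absurd hg (by simp [g, hz])
        · refine ⟨z, ?_, rfl⟩
          have : some (Quotient.mk e.rel z) = some (Quotient.mk e.rel x) :=
            (if_neg hz).symm.trans hg
          exact Quotient.exact (Option.some_injective _ this)
      · exact absurd hg (by simp [g])
    · rintro ⟨y, hy, rfl⟩
      exact stack_upper (a := .inr y) (b := .inr x) hy
  ext C
  constructor
  · rintro ⟨⟨z, rfl⟩, hC⟩
    obtain ⟨x, rfl⟩ := hC z (Setoid.refl' (stack _ _) z)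
    -- a vertical line connects the free nodes of the middle row to the top row
    have hx : x ∉ e.freeNodes := by
      intro hx
      rcases e.free_or x with ⟨j, rfl⟩ | ⟨y, hy, hyx⟩
      · have h : stack (glue e' e τ).rel (glue e f π).rel (topMid (.inl (e'.free (τ j))))
            (topMid (.inr (e.free j))) := stack_upper ⟨j, rfl, rfl⟩
        obtain ⟨a, ha⟩ := hC _ h
        exact absurd ha (by simp [topMid])
      · exact hy ((e.mem_freeNodes x).1 hx y (Setoid.symm' _ hyx))
    exact ⟨x, hx, Set.ext fun z => key x hx z⟩
  · rintro ⟨x, hx, rfl⟩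
    refine ⟨⟨.inr (.inl x), (Set.ext fun z => key x hx z).symm⟩, ?_⟩
    rintro z ⟨y, -, rfl⟩
    exact ⟨y, rfl⟩

/-- The number of closed loops depends on the inner dangle only. -/
theorem loops_glue (e' e f : SymDangle n k) (τ π : Equiv.Perm (Fin (2 * (n - k)))) :
    (glue e' e τ).loops (glue e f π) = (glue e e 1).loops (glue e e 1) := by
  unfold BrauerDiagram.loops BrauerC.loops
  rw [loopClasses_glue, loopClasses_glue]

/-! ### Comparison of dangles -/

/-- A coarser dangle has more arcs. -/
theorem le_of_rel_le {k' : ℕ} (f : SymDangle n k) (f' : SymDangle n k')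
    (h : ∀ x y, f.rel x y → f'.rel x y) : k ≤ k' := by
  have h1 := f.card
  have h2 := f'.card
  have h3 : {x | ∀ y, f'.rel x y → y = x}.ncard ≤ {x | ∀ y, f.rel x y → y = x}.ncard :=
    Set.ncard_le_ncard (fun x (hx : ∀ y, f'.rel x y → y = x) y hy => hx y (h _ _ hy))
      (Set.toFinite _)
  omega

theorem eq_of_rel_le (f f' : SymDangle n k) (h : ∀ x y, f.rel x y → f'.rel x y) : f = f' := by
  have hfree : {x | ∀ y, f'.rel x y → y = x} = {x | ∀ y, f.rel x y → y = x} := by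
    have h1 := f.card
    have h2 := f'.card
    have h3 : {x | ∀ y, f.rel x y → y = x}.ncard ≤ {x | ∀ y, f'.rel x y → y = x}.ncard := by omega
    exact Set.eq_of_subset_of_ncard_le
      (fun x (hx : ∀ y, f'.rel x y → y = x) y hy => hx y (h _ _ hy)) h3 (Set.toFinite _)
  ext x y
  refine ⟨h x y, fun hxy => ?_⟩
  by_cases hyx : y = x
  · rw [hyx]
  have hx : x ∉ {x | ∀ y, f.rel x y → y = x} := by
    rw [← hfree]
    exact fun hx => hyx (hx y hxy)
  simp only [Set.mem_ofPred_eq, not_forall] at hx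
  obtain ⟨z, hz, hzx⟩ := hx
  rcases f'.two x y z hxy (h _ _ hz) with h1 | h1 | h1
  · exact absurd h1.symm hyx
  · exact absurd h1.symm hzx
  · rwa [h1]

theorem flip_glue (e f : SymDangle n k) (π : Equiv.Perm (Fin (2 * (n - k)))) :
    (glue e f π).flip = glue f e π⁻¹ := by
  apply BrauerDiagram.ext
  apply (glue e f π).flip.isMatching.eq_of_le (glue f e π⁻¹).isMatching
  have aux : ∀ x y, Glue e f π (.inl x) (.inr y) → Glue f e π⁻¹ (.inl y) (.inr x) := by
    rintro x y ⟨j, rfl, rfl⟩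
    exact ⟨π j, by simp, rfl⟩
  rintro (x | x) (y | y) h
  · exact h
  · exact aux _ _ h
  · exact aux _ _ h
  · exact h

/-! ### Cutting symmetric diagrams -/

theorem rel_iff_of_glue_eq {k' : ℕ} {e f : SymDangle n k} {e' f' : SymDangle n k'}
    {π : Equiv.Perm (Fin (2 * (n - k)))} {π' : Equiv.Perm (Fin (2 * (n - k')))}
    (h : glue e f π = glue e' f' π') :
    (∀ x y, e.rel x y ↔ e'.rel x y) ∧ ∀ x y, f.rel x y ↔ f'.rel x y := by
  have h' : ∀ x y, Glue e f π x y ↔ Glue e' f' π' x y := fun x y =>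
    iff_of_eq (congrArg (fun d : BrauerDiagram (2 * n) => d.rel x y) h)
  exact ⟨fun x y => h' (.inl x) (.inl y), fun x y => h' (.inr x) (.inr y)⟩

theorem glue_injective {e f e' f' : SymDangle n k} {π π' : Equiv.Perm (Fin (2 * (n - k)))}
    (h : glue e f π = glue e' f' π') : e = e' ∧ f = f' ∧ π = π' := by
  obtain ⟨h1, h2⟩ := rel_iff_of_glue_eq h
  obtain rfl : e = e' := e.eq_of_rel_le e' fun x y => (h1 x y).1
  obtain rfl : f = f' := f.eq_of_rel_le f' fun x y => (h2 x y).1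
  refine ⟨rfl, rfl, Equiv.ext fun j => ?_⟩
  have h3 : Glue e f π' (.inl (e.free (π j))) (.inr (f.free j)) := by
    have : Glue e f π (.inl (e.free (π j))) (.inr (f.free j)) := ⟨j, rfl, rfl⟩
    exact (iff_of_eq (congrArg (fun d : BrauerDiagram (2 * n) => d.rel _ _) h)).1 this
  obtain ⟨j', h4, h5⟩ := h3
  rw [f.free.injective h5] at h4
  exact (e.free.injective h4).symm

end SymDangle

namespace BrauerDiagram

variable {N : ℕ}

/-- The northern nodes of vertical lines. -/
def northFree (d : BrauerDiagram N) : Set (Fin N) := {x | ∀ y, d.rel (.inl x) (.inl y) → y = x}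

theorem exists_inr_of_mem_northFree (d : BrauerDiagram N) {x : Fin N} (hx : x ∈ d.northFree) :
    ∃ y, d.rel (.inl x) (.inr y) := by
  obtain ⟨z | z, ⟨h1, h2⟩, -⟩ := d.isMatching (.inl x)
  · exact absurd (congrArg _ (hx z (Setoid.symm' _ h2))) h1
  · exact ⟨z, Setoid.symm' _ h2⟩

theorem eq_of_rel (d : BrauerDiagram N) {x y z : Fin N ⊕ Fin N} (hy : d.rel x y) (hz : d.rel x z)
    (h1 : y ≠ x) (h2 : z ≠ x) : y = z :=
  (d.isMatching x).unique ⟨h1, Setoid.symm' _ hy⟩ ⟨h2, Setoid.symm' _ hz⟩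

theorem mem_northFree_of_rel (d : BrauerDiagram N) {x y : Fin N} (h : d.rel (.inl x) (.inr y)) :
    x ∈ d.northFree := by
  intro z hz
  by_contra hzx
  have := d.eq_of_rel h hz (by simp) (by simpa using hzx)
  simp at this

/-- The vertical lines embed the northern into the southern nodes on vertical lines. -/
theorem ncard_northFree_le (d : BrauerDiagram N) : d.northFree.ncard ≤ d.flip.northFree.ncard := by
  choose g hg using fun x : d.northFree => d.exists_inr_of_mem_northFree x.2
  have hinj : Function.Injective g := by
    intro x y hxy
    have h1 := Setoid.symm' _ (hg x)
    have h2 := Setoid.symm' _ (hg y)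
    rw [← hxy] at h2
    exact Subtype.ext (Sum.inl_injective (d.eq_of_rel h1 h2 (by simp) (by simp)))
  have hmem : ∀ x, g x ∈ d.flip.northFree := fun x =>
    d.flip.mem_northFree_of_rel (y := x) (Setoid.symm' _ (hg x))
  have hle := Nat.card_le_card_of_injective (fun x => (⟨g x, hmem x⟩ : d.flip.northFree))
    fun x y h => hinj (congrArg Subtype.val h)
  rwa [Nat.card_coe_set_eq, Nat.card_coe_set_eq] at hle

theorem ncard_northFree_flip (d : BrauerDiagram N) :
    d.flip.northFree.ncard = d.northFree.ncard := by
  have h1 := d.ncard_northFree_le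
  have h2 := d.flip.ncard_northFree_le
  have h3 : d.flip.flip = d := BrauerDiagram.ext (flip_flip _)
  rw [h3] at h2
  exact le_antisymm h2 h1

/-- The northern arcs of a symmetric diagram form a symmetric dangle. -/
def northDangle {n k : ℕ} (d : BrauerDiagram (2 * n)) (hd : d.IsSymmetric)
    (hk : d.northFree.ncard + 2 * k = 2 * n) : SymDangle n k where
  rel := d.rel.comap .inl
  two x y z hy hz := by
    by_cases h1 : x = y
    · exact .inl h1
    by_cases h2 : x = z
    · exact .inr (.inl h2)
    exact .inr (.inr (Sum.inl_injective (d.eq_of_rel hy hz (fun h => h1 (Sum.inl_injective h).symm)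
      fun h => h2 (Sum.inl_injective h).symm)))
  symm x y h := hd _ _ h
  card := by
    have h : {x | ∀ y, d.rel.comap .inl x y → y = x} = d.northFree := Set.ext fun x => Iff.rfl
    rw [h, hk]

/-- The vertical lines of a symmetric diagram are permuted by the reflection in the vertical axis,
which fixes none of them. -/
theorem even_ncard_northFree {n : ℕ} (d : BrauerDiagram (2 * n)) (hd : d.IsSymmetric) :
    Even d.northFree.ncard := by
  classical
  have hrev : ∀ x ∈ d.northFree, x.rev ∈ d.northFree := by
    intro x hx y hy
    have := hx y.rev (by simpa using hd _ _ hy)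
    rw [← this, Fin.rev_rev]
  let φ : d.northFree → d.northFree := fun x => ⟨x.1.rev, hrev _ x.2⟩
  have h2 := Equiv.Perm.card_fixedPoints_modEq (f := (φ : Function.End d.northFree)) (p := 2)
    (n := 1) (funext fun x => Subtype.ext (Fin.rev_rev x.1))
  have h3 : IsEmpty (Function.fixedPoints φ) := by
    constructor
    rintro ⟨x, hx⟩
    have h4 := congrArg (fun y : d.northFree => (y : Fin (2 * n)).val) hx
    simp only [φ, Fin.val_rev] at h4
    have := x.1.isLt
    omega
  rw [Fintype.card_eq_zero_iff.2 h3] at h2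
  rw [← Nat.card_coe_set_eq, Nat.card_eq_fintype_card, Nat.even_iff]
  exact h2

/-- Every symmetric diagram is obtained from two symmetric dangles and an element of a
hyperoctahedral group. -/
theorem IsSymmetric.exists_glue {n : ℕ} {d : BrauerDiagram (2 * n)} (hd : d.IsSymmetric) :
    ∃ (k : Fin (n + 1)) (e f : SymDangle n k) (π : Hyperoctahedral (n - k)),
      SymDangle.glue e f π.1 = d := by
  obtain ⟨m, hm⟩ := d.even_ncard_northFree hd
  have hle : d.northFree.ncard ≤ 2 * n := by
    simpa using Set.ncard_le_card d.northFree
  have hk : d.northFree.ncard + 2 * (n - m) = 2 * n := by omega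
  have hk' : d.flip.northFree.ncard + 2 * (n - m) = 2 * n := by rw [ncard_northFree_flip, hk]
  obtain ⟨k, hkm⟩ : ∃ k : Fin (n + 1), (k : ℕ) = n - m := ⟨⟨n - m, by omega⟩, rfl⟩
  rw [← hkm] at hk hk'
  set e := d.northDangle hd hk with he
  set f := d.flip.northDangle hd.flip hk' with hf
  -- the northern end of a vertical line with given southern end
  have hline : ∀ j, ∃ j', d.rel (.inl (e.free j')) (.inr (f.free j)) := by
    intro j
    have h1 : f.free j ∈ d.flip.northFree := fun y hy => f.free_eq hy
    obtain ⟨x, hx⟩ := d.flip.exists_inr_of_mem_northFree h1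
    have hx' : d.rel (.inl x) (.inr (f.free j)) := Setoid.symm' d.rel hx
    rcases e.free_or x with ⟨j', rfl⟩ | ⟨y, hy, hyx⟩
    · exact ⟨j', hx'⟩
    · exact absurd (d.mem_northFree_of_rel hx' y (Setoid.symm' e.rel hyx)) hy
  choose π hπ using hline
  have hinj : Function.Injective π := by
    intro i j hij
    have h1 := hπ i
    rw [hij] at h1
    exact f.free.injective (Sum.inr_injective (d.eq_of_rel h1 (hπ j) (by simp) (by simp)))
  let σ : Equiv.Perm (Fin (2 * (n - k))) :=
    Equiv.ofBijective π (Finite.injective_iff_bijective.1 hinj)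
  have hσ : σ ∈ Hyperoctahedral (n - k) := by
    rw [Subgroup.mem_centralizer_singleton_iff]
    ext1 j
    change π j.rev = (π j).rev
    have h1 := hd _ _ (hπ j)
    have h2 := hπ j.rev
    rw [SymDangle.free_rev] at h2
    change d.rel (.inl (e.free (π j)).rev) (.inr (f.free j).rev) at h1
    rw [← SymDangle.free_rev] at h1
    exact e.free.injective (Sum.inl_injective (d.eq_of_rel (Setoid.symm' _ h2) (Setoid.symm' _ h1)
      (by simp) (by simp)))
  refine ⟨k, e, f, ⟨σ, hσ⟩, BrauerDiagram.ext ?_⟩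
  apply (SymDangle.glue e f σ).isMatching.eq_of_le d.isMatching
  rintro (x | x) (y | y) h
  · exact h
  · obtain ⟨j, rfl, rfl⟩ := h
    exact hπ j
  · obtain ⟨j, rfl, rfl⟩ := h
    exact Setoid.symm' _ (hπ j)
  · exact h

end BrauerDiagram

/-! ### Inflation of a cell ideal -/

section Inflation

variable {R Q H E : Type*} [CommRing R] [Ring Q] [Algebra R Q] [Ring H] [Algebra R H]

/-- The matrices with entries in `J`, as elements of `Q`. The column index comes first, which is the
order in which the tensor product of columns and rows is expanded in `exists_matMap_iso`. -/
def matMap (L : (E → E → H) →ₗ[R] Q) (J : Submodule R H) : (E → E → J) →ₗ[R] Q :=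
  L ∘ₗ LinearMap.pi fun e => LinearMap.pi fun f =>
    J.subtype ∘ₗ LinearMap.proj e ∘ₗ LinearMap.proj f

theorem matMap_apply (L : (E → E → H) →ₗ[R] Q) (J : Submodule R H) (w : E → E → J) :
    matMap L J w = L fun e f => (w f e : H) := rfl

/-- The column `u` times the row `v`, as an element of `Q`. -/
def colMap (L : (E → E → H) →ₗ[R] Q) (v : E → R) (Δ : Submodule R H) : (E → Δ) →ₗ[R] Q :=
  L ∘ₗ LinearMap.pi fun e => LinearMap.pi fun f => v f • (Δ.subtype ∘ₗ LinearMap.proj e)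

theorem colMap_apply (L : (E → E → H) →ₗ[R] Q) (v : E → R) (Δ : Submodule R H) (u : E → Δ) :
    colMap L v Δ u = L fun e f => v f • (u e : H) := rfl

/-- The column `v` times the row `w`, as an element of `Q`. -/
def rowMap (L : (E → E → H) →ₗ[R] Q) (v : E → R) (Δ : Submodule R H) : (E → Δ) →ₗ[R] Q :=
  L ∘ₗ LinearMap.pi fun e => LinearMap.pi fun f => v e • (Δ.subtype ∘ₗ LinearMap.proj f)

theorem rowMap_apply (L : (E → E → H) →ₗ[R] Q) (v : E → R) (Δ : Submodule R H) (w : E → Δ) :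
    rowMap L v Δ w = L fun e f => v e • (w f : H) := rfl

theorem matMap_injective {L : (E → E → H) →ₗ[R] Q} (hL : Function.Injective L)
    (J : Submodule R H) : Function.Injective (matMap L J) := by
  intro w w' h
  have h1 := hL h
  funext f e
  exact Subtype.ext (congrFun (congrFun h1 e) f)

/-- A family of scalars with zero annihilator has zero annihilator on free modules. -/
theorem eq_of_smul_eq {M : Type*} [AddCommGroup M] [Module R M] [Module.Free R M] {v : E → R}
    (hv : ∀ r : R, (∀ f, r * v f = 0) → r = 0) {x y : M} (h : ∀ f, v f • x = v f • y) : x = y := by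
  rw [← sub_eq_zero]
  apply (Module.Free.chooseBasis R M).repr.injective
  ext j
  rw [map_zero, Finsupp.zero_apply]
  apply hv
  intro f
  have h1 : v f • (x - y) = 0 := by rw [smul_sub, h f, sub_self]
  have h2 := congrArg (fun z => (Module.Free.chooseBasis R M).repr z j) h1
  simpa [mul_comm] using h2

theorem colMap_injective {L : (E → E → H) →ₗ[R] Q} (hL : Function.Injective L) {v : E → R}
    (hv : ∀ r : R, (∀ f, r * v f = 0) → r = 0) (Δ : Submodule R H) [Module.Free R Δ] :
    Function.Injective (colMap L v Δ) := by
  intro u u' h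
  have h1 := hL h
  funext e
  exact eq_of_smul_eq hv fun f => Subtype.ext (congrFun (congrFun h1 e) f)

variable {i : AntiInvolution R Q} {ι : AntiInvolution R H}

theorem inv_colMap {L : (E → E → H) →ₗ[R] Q}
    (hi : ∀ w, i.toLin (L w) = L fun e f => ι.toLin (w f e)) (v : E → R) (Δ : Submodule R H)
    (u : E → Δ) :
    i.toLin (colMap L v Δ u) =
      rowMap L v (Δ.map ι.toLin) fun e => ⟨ι.toLin (u e), Submodule.mem_map_of_mem (u e).2⟩ := by
  rw [colMap_apply, rowMap_apply, hi]
  simp only [map_smul]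

theorem rowMap_injective {L : (E → E → H) →ₗ[R] Q}
    (hi : ∀ w, i.toLin (L w) = L fun e f => ι.toLin (w f e)) {v : E → R} {Δ : Submodule R H}
    (h : Function.Injective (colMap L v Δ)) :
    Function.Injective (rowMap L v (Δ.map ι.toLin)) := by
  have key : ∀ w : E → Δ.map ι.toLin, ∃ u : E → Δ,
      w = fun e => ⟨ι.toLin (u e), Submodule.mem_map_of_mem (u e).2⟩ := by
    intro w
    choose u hu hw using fun e => (w e).2
    exact ⟨fun e => ⟨u e, hu e⟩, funext fun e => Subtype.ext (hw e).symm⟩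
  intro w w' hw
  obtain ⟨u, rfl⟩ := key w
  obtain ⟨u', rfl⟩ := key w'
  rw [← inv_colMap hi, ← inv_colMap hi] at hw
  have := congrArg i.toLin hw
  rw [i.invol, i.invol] at this
  rw [h this]

theorem range_rowMap {L : (E → E → H) →ₗ[R] Q}
    (hi : ∀ w, i.toLin (L w) = L fun e f => ι.toLin (w f e)) (v : E → R) (Δ : Submodule R H) :
    (rowMap L v (Δ.map ι.toLin)).range = (colMap L v Δ).range.map i.toLin := by
  ext x
  constructor
  · rintro ⟨w, rfl⟩
    choose u hu hw using fun e => (w e).2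
    refine ⟨_, ⟨fun e => ⟨u e, hu e⟩, rfl⟩, ?_⟩
    rw [inv_colMap hi]
    congr 1
    exact funext fun e => Subtype.ext (hw e)
  · rintro ⟨_, ⟨u, rfl⟩, rfl⟩
    exact ⟨_, (inv_colMap hi v Δ u).symm⟩

/-- Compatibility with the left multiplication and with the involution implies compatibility with
the right multiplication. -/
theorem AntiInvolution.right_of_left {J Δ : Submodule R Q}
    (β : (Δ ⊗[R] Δ.map i.toLin) →ₗ[R] J)
    (hl : ∀ (a : Q) (x x' : Δ) (y : Δ.map i.toLin), (x' : Q) = a * x →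
      (β (x' ⊗ₜ y) : Q) = a * β (x ⊗ₜ y))
    (hi : ∀ (x x' : Δ) (y y' : Δ.map i.toLin), (x' : Q) = i.toLin y → (y' : Q) = i.toLin x →
      i.toLin (β (x ⊗ₜ y)) = β (x' ⊗ₜ y'))
    (a : Q) (x : Δ) (y y' : Δ.map i.toLin) (h : (y' : Q) = y * a) :
    (β (x ⊗ₜ y') : Q) = β (x ⊗ₜ y) * a := by
  have hmem : ∀ z : Δ.map i.toLin, i.toLin z ∈ Δ := by
    rintro ⟨_, z, hz, rfl⟩
    rw [i.invol]
    exact hz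
  have hx : i.toLin x ∈ Δ.map i.toLin := Submodule.mem_map_of_mem x.2
  rw [← i.invol (β (x ⊗ₜ y')), ← i.invol (β (x ⊗ₜ y) * a), i.map_mul,
    hi x ⟨_, hmem y⟩ y ⟨_, hx⟩ rfl rfl, hi x ⟨_, hmem y'⟩ y' ⟨_, hx⟩ rfl rfl,
    hl (i.toLin a) ⟨_, hmem y⟩ ⟨_, hmem y'⟩ ⟨_, hx⟩ (by rw [← i.map_mul, ← h])]

variable [Fintype E] [DecidableEq E]

/-- The bimodule isomorphism of an inflated cell ideal: the column `u` times `v` and `v` times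
the row `w` are combined to the matrix with entries `b (u e ⊗ w f)`. -/
theorem exists_matMap_iso {L : (E → E → H) →ₗ[R] Q} (hL : Function.Injective L) {v : E → R}
    (hi : ∀ w, i.toLin (L w) = L fun e f => ι.toLin (w f e)) {J Δ : Submodule R H}
    (hinj : Function.Injective (colMap L v Δ)) (b : (Δ ⊗[R] Δ.map ι.toLin) ≃ₗ[R] J) :
    ∃ β : ((colMap L v Δ).range ⊗[R] (colMap L v Δ).range.map i.toLin) ≃ₗ[R] (matMap L J).range,
      ∀ (u : E → Δ) (w : E → Δ.map ι.toLin) (x : (colMap L v Δ).range)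
        (y : (colMap L v Δ).range.map i.toLin), (x : Q) = colMap L v Δ u →
        (y : Q) = rowMap L v (Δ.map ι.toLin) w →
        (β (x ⊗ₜ y) : Q) = L fun e f => (b (u e ⊗ₜ w f) : H) := by
  -- (columns over `Δ`) `⊗` (rows over `ι(Δ)`) is the product of copies of `Δ ⊗ ι(Δ)`, one for each
  -- entry
  let c : (E → Δ) ≃ₗ[R] (colMap L v Δ).range := LinearEquiv.ofInjective _ hinj
  let r : (E → Δ.map ι.toLin) ≃ₗ[R] (colMap L v Δ).range.map i.toLin :=
    LinearEquiv.ofInjective _ (rowMap_injective hi hinj) ≪≫ₗ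
      LinearEquiv.ofEq _ _ (range_rowMap hi v Δ)
  let m : (E → E → J) ≃ₗ[R] (matMap L J).range := LinearEquiv.ofInjective _ (matMap_injective hL J)
  let β := TensorProduct.congr c.symm r.symm ≪≫ₗ TensorProduct.piRight R R (E → Δ) _ ≪≫ₗ
    LinearEquiv.piCongrRight (fun _ : E =>
      TensorProduct.piLeft R (Δ.map ι.toLin) (fun _ : E => Δ) ≪≫ₗ
        LinearEquiv.piCongrRight (fun _ : E => b)) ≪≫ₗ m
  refine ⟨β, fun u w x y hx hy => ?_⟩
  obtain rfl : x = c u := Subtype.ext hx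
  obtain rfl : y = r w := Subtype.ext hy
  have h1 : β (c u ⊗ₜ r w) = m fun f e => b (u e ⊗ₜ w f) := by
    simp only [β, LinearEquiv.trans_apply, TensorProduct.congr_tmul, LinearEquiv.symm_apply_apply]
    congr 1
  rw [h1]
  exact matMap_apply L J _

/-- Let `L` identify the matrices over `H` with a part of `Q` on which `Q` acts
from the left through matrices over `H` and the involution acts as the conjugate transpose. Then a
cell ideal `J` of `H` with cell module `Δ` gives the cell ideal of the matrices over `J`; its cell
module consists of the columns over `Δ`, multiplied by a fixed row `v` with zero annihilator. -/
theorem IsCellIdeal.inflate {L : (E → E → H) →ₗ[R] Q} (hL : Function.Injective L) {v : E → R}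
    (hv : ∀ r : R, (∀ f, r * v f = 0) → r = 0)
    (hi : ∀ w, i.toLin (L w) = L fun e f => ι.toLin (w f e))
    (hm : ∀ a : Q, ∃ M : E → E → H, ∀ w, a * L w = L fun e' f => ∑ e, M e' e * w e f)
    {J Δ : Submodule R H} (hc : IsCellIdeal ι J Δ) :
    IsCellIdeal i (matMap L J).range (colMap L v Δ).range := by
  have := hc.free
  have := hc.finite
  have hinj : Function.Injective (colMap L v Δ) := colMap_injective hL hv Δ
  have hmem : ∀ w : E → E → H, (∀ e f, w e f ∈ J) → L w ∈ (matMap L J).range :=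
    fun w hw => ⟨fun f e => ⟨w e f, hw e f⟩, rfl⟩
  have hJi : ∀ x ∈ J, ι.toLin x ∈ J := fun x hx => by
    rw [← hc.map_inv]; exact Submodule.mem_map_of_mem hx
  have hleft : ∀ a, ∀ x ∈ (matMap L J).range, a * x ∈ (matMap L J).range := by
    rintro a _ ⟨w, rfl⟩
    obtain ⟨M, hM⟩ := hm a
    rw [matMap_apply, hM]
    exact hmem _ fun e f => Submodule.sum_mem _ fun e' _ => hc.mul_left _ _ (w _ _).2
  have hinv : ∀ x ∈ (matMap L J).range, i.toLin x ∈ (matMap L J).range := by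
    rintro _ ⟨w, rfl⟩
    rw [matMap_apply, hi]
    exact hmem _ fun e f => hJi _ (w _ _).2
  -- left multiplication of a column
  have hcol : ∀ (a : Q) (M : E → E → H), (∀ w, a * L w = L fun e' f => ∑ e, M e' e * w e f) →
      ∀ u : E → Δ, a * colMap L v Δ u = colMap L v Δ fun e' =>
        ∑ e, ⟨M e' e * u e, hc.left_ideal _ _ (u e).2⟩ := by
    intro a M hM u
    rw [colMap_apply, colMap_apply, hM]
    congr 1
    funext e' f
    rw [AddSubmonoidClass.coe_finsetSum, Finset.smul_sum]
    exact Finset.sum_congr rfl fun e _ => mul_smul_comm _ _ _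
  obtain ⟨b, hb1, hb2, hb3⟩ := hc.exists_iso
  obtain ⟨β, hβ⟩ := exists_matMap_iso hL hi hinj b
  have hrow : ∀ y : (colMap L v Δ).range.map i.toLin, ∃ w,
      (y : Q) = rowMap L v (Δ.map ι.toLin) w := by
    rintro ⟨y, hy⟩
    rw [← range_rowMap hi] at hy
    obtain ⟨w, rfl⟩ := hy
    exact ⟨w, rfl⟩
  have hβl : ∀ (a : Q) (x x' : (colMap L v Δ).range) (y : (colMap L v Δ).range.map i.toLin),
      (x' : Q) = a * x → (β (x' ⊗ₜ y) : Q) = a * β (x ⊗ₜ y) := by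
    rintro a ⟨_, u, rfl⟩ x' y hx'
    obtain ⟨w, hw⟩ := hrow y
    obtain ⟨M, hM⟩ := hm a
    rw [hβ u w ⟨_, u, rfl⟩ y rfl hw, hM, hβ _ w x' y (hx'.trans (hcol a M hM u)) hw]
    congr 1
    funext e' f
    rw [TensorProduct.sum_tmul, map_sum, AddSubmonoidClass.coe_finsetSum]
    exact Finset.sum_congr rfl fun e _ => hb1 _ _ _ _ rfl
  have hβi : ∀ (x x' : (colMap L v Δ).range) (y y' : (colMap L v Δ).range.map i.toLin),
      (x' : Q) = i.toLin y → (y' : Q) = i.toLin x → i.toLin (β (x ⊗ₜ y)) = β (x' ⊗ₜ y') := by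
    rintro ⟨_, u, rfl⟩ x' ⟨_, _, ⟨u', rfl⟩, rfl⟩ y' hx' hy'
    rw [i.invol] at hx'
    rw [hβ u _ _ _ rfl (inv_colMap hi v Δ u'), hi,
      hβ u' _ x' y' hx' (hy'.trans (inv_colMap hi v Δ u))]
    congr 1
    funext e f
    exact hb3 _ _ _ _ (ι.invol _).symm rfl
  exact
  { mul_left := hleft
    mul_right := by
      intro a x hx
      rw [← i.invol (x * a), i.map_mul]
      exact hinv _ (hleft _ _ (hinv _ hx))
    map_inv := by
      apply le_antisymm
      · rintro _ ⟨x, hx, rfl⟩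
        exact hinv x hx
      · intro x hx
        exact ⟨_, hinv x hx, i.invol x⟩
    le := by
      rintro _ ⟨u, rfl⟩
      exact hmem _ fun e f => J.smul_mem _ (hc.le (u e).2)
    left_ideal := by
      rintro a _ ⟨u, rfl⟩
      obtain ⟨M, hM⟩ := hm a
      rw [hcol a M hM]
      exact ⟨_, rfl⟩
    finite := Module.Finite.equiv (LinearEquiv.ofInjective _ hinj)
    free := Module.Free.of_equiv (LinearEquiv.ofInjective _ hinj)
    exists_iso := ⟨β, hβl, AntiInvolution.right_of_left β.toLinearMap hβl hβi, hβi⟩ }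

end Inflation

/-! ### Finite direct sums and their projections -/

section Projections

variable {R M I : Type*} [CommRing R] [AddCommGroup M] [Module R M] [Fintype I]

/-- `P` is the family of projections of `M` onto the summands of a direct sum decomposition
`M = ⨁ S l`. -/
structure IsProjFamily (S : I → Submodule R M) (P : I → M →ₗ[R] M) : Prop where
  mem : ∀ l x, P l x ∈ S l
  sum : ∀ x, ∑ l, P l x = x
  of_mem : ∀ l x, x ∈ S l → P l x = x
  of_mem_ne : ∀ l m x, l ≠ m → x ∈ S l → P m x = 0

theorem exists_isProjFamily [DecidableEq I] {S : I → Submodule R M} (h : DirectSum.IsInternal S) :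
    ∃ P, IsProjFamily S P := by
  let φ := LinearEquiv.ofBijective (DirectSum.coeLinearMap S) h
  let P : I → M →ₗ[R] M := fun l =>
    (S l).subtype ∘ₗ DirectSum.component R I (fun l => S l) l ∘ₗ φ.symm.toLinearMap
  have h1 : ∀ l x, x ∈ S l → P l x = x := fun l x hx =>
    congrArg Subtype.val (h.ofBijective_coeLinearMap_of_mem hx)
  have h2 : ∀ l m x, l ≠ m → x ∈ S l → P m x = 0 := fun l m x hlm hx =>
    congrArg Subtype.val (h.ofBijective_coeLinearMap_of_mem_ne hlm hx)
  refine ⟨P, fun l x => Subtype.property _, fun x => ?_, h1, h2⟩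
  have hx : x ∈ ⨆ l, S l := by rw [h.submodule_iSup_eq_top]; trivial
  have hle : (⨆ l, S l) ≤ LinearMap.eqLocus (∑ l, P l) LinearMap.id := by
    refine iSup_le fun l y hy => ?_
    rw [LinearMap.mem_eqLocus, LinearMap.sum_apply,
      Finset.sum_eq_single l (fun m _ hm => h2 l m y hm.symm hy) (by simp), h1 l y hy]
    rfl
  have := hle hx
  rwa [LinearMap.mem_eqLocus, LinearMap.sum_apply] at this

variable {S : I → Submodule R M} {P : I → M →ₗ[R] M}

theorem IsProjFamily.mem_iSup_iff (h : IsProjFamily S P) (p : I → Prop) (x : M) :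
    x ∈ ⨆ m, ⨆ _ : p m, S m ↔ ∀ m, ¬ p m → P m x = 0 := by
  constructor
  · intro hx m hm
    have : (⨆ m, ⨆ _ : p m, S m) ≤ (P m).ker := by
      refine iSup₂_le fun l hl y hy => h.of_mem_ne l m y ?_ hy
      rintro rfl
      exact hm hl
    exact this hx
  · intro hx
    rw [← h.sum x]
    refine Submodule.sum_mem _ fun m _ => ?_
    by_cases hm : p m
    · exact le_iSup₂_of_le (f := fun m (_ : p m) => S m) m hm le_rfl (h.mem m x)
    · rw [hx m hm]
      exact Submodule.zero_mem _

theorem IsProjFamily.isInternal [DecidableEq I] (h : IsProjFamily S P) :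
    DirectSum.IsInternal S := by
  apply DirectSum.isInternal_submodule_of_iSupIndep_of_iSup_eq_top
  · intro l
    rw [Submodule.disjoint_def]
    intro x hx hx'
    rw [← h.of_mem l x hx]
    exact (h.mem_iSup_iff (fun m => m ≠ l) x).1 hx' l (by simp)
  · rw [eq_top_iff]
    intro x _
    rw [← h.sum x]
    exact Submodule.sum_mem _ fun l _ => le_iSup S l (h.mem l x)

end Projections

/-! ### Algebras with layers of matrices -/

/-- A linear map factors injectively through a surjective linear map with the same kernel. -/
theorem exists_injective_comp_eq {R X Y Z : Type*} [CommRing R] [AddCommGroup X] [AddCommGroup Y]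
    [AddCommGroup Z] [Module R X] [Module R Y] [Module R Z] (g : X →ₗ[R] Y) (f : X →ₗ[R] Z)
    (hg : Function.Surjective g) (h : ∀ x, g x = 0 ↔ f x = 0) :
    ∃ L : Y →ₗ[R] Z, Function.Injective L ∧ ∀ x, L (g x) = f x := by
  let q := g.quotKerEquivOfSurjective hg
  let L := g.ker.liftQ f (fun x hx => (h x).1 hx) ∘ₗ q.symm.toLinearMap
  have hL : ∀ x, L (g x) = f x := by
    intro x
    have : q.symm (g x) = g.ker.mkQ x := by
      rw [LinearEquiv.symm_apply_eq]; rfl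
    change g.ker.liftQ f (fun x hx => (h x).1 hx) (q.symm (g x)) = f x
    rw [this]
    rfl
  refine ⟨L, ?_, hL⟩
  rw [injective_iff_map_eq_zero]
  intro y hy
  obtain ⟨x, rfl⟩ := hg y
  rw [hL] at hy
  exact (h x).2 hy

section Order

variable {K : Type*} {Λ : K → Type*} [LinearOrder K] [∀ k, LinearOrder (Λ k)]

theorem toLex_lt_of_lt {k k' : K} (h : k' < k) (μ' : Λ k') (μ : Λ k) :
    (toLex ⟨k', μ'⟩ : Σₗ k, Λ k) < toLex ⟨k, μ⟩ := Sigma.Lex.left _ _ h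

theorem toLex_le_iff {k : K} (μ' μ : Λ k) :
    (toLex ⟨k, μ'⟩ : Σₗ k, Λ k) ≤ toLex ⟨k, μ⟩ ↔ μ' ≤ μ := by
  constructor
  · rintro (⟨_, _, h⟩ | ⟨_, _, h⟩)
    · exact absurd h (lt_irrefl _)
    · exact h
  · intro h
    exact Sigma.Lex.right _ _ h

theorem toLex_lt_iff {k : K} (μ' μ : Λ k) :
    (toLex ⟨k, μ'⟩ : Σₗ k, Λ k) < toLex ⟨k, μ⟩ ↔ μ' < μ := by
  rw [← not_le, ← not_le, toLex_le_iff]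

end Order

/-- A decomposition of the `R`-module `A` into layers, the layer `k` being the module of the
`E k × E k`-matrices over an algebra `H k`, such that the involution acts on each layer as the
conjugate transpose, and `A` acts on each layer from the left through matrices over `H k`, modulo
lower layers. -/
structure MatrixLayers {R A K : Type*} [CommRing R] [Ring A] [Algebra R A] [LinearOrder K]
    {H : K → Type*} [∀ k, Ring (H k)] [∀ k, Algebra R (H k)] (i : AntiInvolution R A)
    (ι : ∀ k, AntiInvolution R (H k)) (E : K → Type*) [∀ k, Fintype (E k)] where
  coord : A ≃ₗ[R] ∀ k, E k → E k → H k
  coord_inv : ∀ x k e f, coord (i.toLin x) k e f = (ι k).toLin (coord x k f e)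
  coord_mul : ∀ a k, ∃ M : E k → E k → H k, ∀ x, (∀ k' > k, coord x k' = 0) →
    (∀ k' > k, coord (a * x) k' = 0) ∧
      ∀ e' f, coord (a * x) k e' f = ∑ e, M e' e * coord x k e f

namespace MatrixLayers

variable {R A K : Type*} [CommRing R] [Ring A] [Algebra R A] [LinearOrder K]
  {H : K → Type*} [∀ k, Ring (H k)] [∀ k, Algebra R (H k)] {i : AntiInvolution R A}
  {ι : ∀ k, AntiInvolution R (H k)} {E : K → Type*} [∀ k, Fintype (E k)]
  (T : MatrixLayers i ι E)

/-- The matrices in layer `k` with entries in `S`. -/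
def layerPart (k : K) (S : Submodule R (H k)) : Submodule R A where
  carrier := {x | (∀ k' ≠ k, T.coord x k' = 0) ∧ ∀ e f, T.coord x k e f ∈ S}
  zero_mem' := ⟨fun k' _ => by simp, fun e f => by simp⟩
  add_mem' := by
    rintro x y ⟨h1, h2⟩ ⟨h3, h4⟩
    exact ⟨fun k' hk => by simp [h1 k' hk, h3 k' hk],
      fun e f => by simpa using S.add_mem (h2 e f) (h4 e f)⟩
  smul_mem' := by
    rintro r x ⟨h1, h2⟩
    exact ⟨fun k' hk => by simp [h1 k' hk], fun e f => by simpa using S.smul_mem r (h2 e f)⟩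

/-- The elements without components in the layers above `k`, whose component in layer `k` has
entries in `S`. -/
def lowerPart (k : K) (S : Submodule R (H k)) : Submodule R A where
  carrier := {x | (∀ k' > k, T.coord x k' = 0) ∧ ∀ e f, T.coord x k e f ∈ S}
  zero_mem' := ⟨fun k' _ => by simp, fun e f => by simp⟩
  add_mem' := by
    rintro x y ⟨h1, h2⟩ ⟨h3, h4⟩
    exact ⟨fun k' hk => by simp [h1 k' hk, h3 k' hk],
      fun e f => by simpa using S.add_mem (h2 e f) (h4 e f)⟩
  smul_mem' := by
    rintro r x ⟨h1, h2⟩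
    exact ⟨fun k' hk => by simp [h1 k' hk], fun e f => by simpa using S.smul_mem r (h2 e f)⟩

theorem mem_lowerPart {k : K} {S : Submodule R (H k)} {x : A} :
    x ∈ T.lowerPart k S ↔ (∀ k' > k, T.coord x k' = 0) ∧ ∀ e f, T.coord x k e f ∈ S := Iff.rfl

theorem mul_mem_lowerPart {k : K} {S : Submodule R (H k)} (hS : ∀ a, ∀ x ∈ S, a * x ∈ S)
    (a : A) {x : A} (hx : x ∈ T.lowerPart k S) : a * x ∈ T.lowerPart k S := by
  obtain ⟨M, hM⟩ := T.coord_mul a k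
  obtain ⟨h1, h2⟩ := hM x hx.1
  refine ⟨h1, fun e f => ?_⟩
  rw [h2]
  exact S.sum_mem fun e' _ => hS _ _ (hx.2 e' f)

theorem inv_mem_lowerPart {k : K} {S : Submodule R (H k)} (hS : ∀ x ∈ S, (ι k).toLin x ∈ S)
    {x : A} (hx : x ∈ T.lowerPart k S) : i.toLin x ∈ T.lowerPart k S := by
  refine ⟨fun k' hk' => ?_, fun e f => ?_⟩
  · funext e f
    rw [T.coord_inv, hx.1 k' hk']
    exact map_zero _
  · rw [T.coord_inv]
    exact hS _ (hx.2 f e)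

theorem inv_mem_layerPart {k : K} {S : Submodule R (H k)} (hS : ∀ x ∈ S, (ι k).toLin x ∈ S)
    {x : A} (hx : x ∈ T.layerPart k S) : i.toLin x ∈ T.layerPart k S := by
  refine ⟨fun k' hk' => ?_, fun e f => ?_⟩
  · funext e f
    rw [T.coord_inv, hx.1 k' hk']
    exact map_zero _
  · rw [T.coord_inv]
    exact hS _ (hx.2 f e)

/-- The projection to layer `k`, followed by a map of the entries. -/
def layerProj (k : K) (p : H k →ₗ[R] H k) : A →ₗ[R] A :=
  T.coord.symm.toLinearMap ∘ₗ LinearMap.single R _ k ∘ₗ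
    (LinearMap.pi fun e => LinearMap.pi fun f =>
      p ∘ₗ LinearMap.proj f ∘ₗ LinearMap.proj e ∘ₗ LinearMap.proj k) ∘ₗ T.coord.toLinearMap

theorem coord_layerProj (k : K) (p : H k →ₗ[R] H k) (x : A) :
    T.coord (T.layerProj k p x) = Pi.single k fun e f => p (T.coord x k e f) :=
  T.coord.apply_symm_apply _

theorem layerProj_eq_zero_iff (k : K) (p : H k →ₗ[R] H k) (x : A) :
    T.layerProj k p x = 0 ↔ ∀ e f, p (T.coord x k e f) = 0 := by
  rw [← T.coord.map_eq_zero_iff, coord_layerProj, Pi.single_eq_zero_iff]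
  exact ⟨fun h e f => congrFun (congrFun h e) f, fun h => funext fun e => funext fun f => h e f⟩

/-- The element with the given matrix in layer `k`. -/
def ofLayer (k : K) : (E k → E k → H k) →ₗ[R] A :=
  T.coord.symm.toLinearMap ∘ₗ LinearMap.single R (fun k => E k → E k → H k) k

theorem coord_ofLayer (k : K) (w : E k → E k → H k) : T.coord (T.ofLayer k w) = Pi.single k w :=
  T.coord.apply_symm_apply _

theorem coord_ofLayer_gt (k : K) (w : E k → E k → H k) :
    ∀ k' > k, T.coord (T.ofLayer k w) k' = 0 := fun k' hk' => by
  rw [coord_ofLayer, Pi.single_eq_of_ne (ne_of_gt hk')]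

theorem coord_ofLayer_same (k : K) (w : E k → E k → H k) : T.coord (T.ofLayer k w) k = w := by
  rw [coord_ofLayer, Pi.single_eq_same]

variable {Λ : K → Type*}

/-- The summands of `A` given by summands of the algebras `H k`. -/
def summand (S : ∀ k, Λ k → Submodule R (H k)) (l : Σₗ k, Λ k) : Submodule R A :=
  T.layerPart (ofLex l).1 (S _ (ofLex l).2)

variable [Fintype K] [∀ k, Fintype (Λ k)]

instance : Fintype (Σₗ k, Λ k) := inferInstanceAs (Fintype (Σ k, Λ k))

theorem isProjFamily {S : ∀ k, Λ k → Submodule R (H k)} {P : ∀ k, Λ k → H k →ₗ[R] H k}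
    (hP : ∀ k, IsProjFamily (S k) (P k)) :
    IsProjFamily (T.summand S) fun l => T.layerProj (ofLex l).1 (P _ (ofLex l).2) where
  mem := by
    rintro ⟨k, μ⟩ x
    refine ⟨fun k' hk' => ?_, fun e f => ?_⟩
    · rw [coord_layerProj]
      exact Pi.single_eq_of_ne hk' _
    · rw [coord_layerProj, Pi.single_eq_same]
      exact (hP k).mem μ _
  sum x := by
    apply T.coord.injective
    have h : ∑ l : Σₗ k, Λ k, T.layerProj (ofLex l).1 (P _ (ofLex l).2) x =
        ∑ k, ∑ μ, T.layerProj k (P k μ) x :=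
      Fintype.sum_sigma fun l : Σ k, Λ k => T.layerProj l.1 (P _ l.2) x
    rw [h, map_sum]
    funext k e f
    simp only [map_sum, coord_layerProj, Finset.sum_apply]
    rw [Finset.sum_eq_single k]
    · simp only [Pi.single_eq_same]
      exact (hP k).sum _
    · intro k' _ hk'
      refine Finset.sum_eq_zero fun μ _ => ?_
      rw [Pi.single_eq_of_ne hk'.symm]
      rfl
    · simp
  of_mem := by
    rintro ⟨k, μ⟩ x ⟨h1, h2⟩
    apply T.coord.injective
    rw [coord_layerProj]
    funext k'
    by_cases hk : k' = k
    · subst hk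
      refine (Pi.single_eq_same k' _).trans ?_
      funext e f
      exact (hP k').of_mem μ _ (h2 e f)
    · exact (Pi.single_eq_of_ne hk _).trans (h1 k' hk).symm
  of_mem_ne := by
    rintro ⟨k, μ⟩ ⟨k', μ'⟩ x hne ⟨h1, h2⟩
    refine (T.layerProj_eq_zero_iff _ _ _).2 fun e f => ?_
    by_cases hk : k' = k
    · subst hk
      refine (hP k').of_mem_ne μ μ' _ ?_ (h2 e f)
      rintro rfl
      exact hne rfl
    · have : T.coord x k' = 0 := h1 k' hk
      change P k' μ' (T.coord x k' e f) = 0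
      rw [this]
      exact map_zero _

variable [∀ k, LinearOrder (Λ k)]

/-- The partial sums of the summands of `A`, in terms of the partial sums of the summands of the
algebra `H k`; the predicates `p` and `q` stand for `· ≤ (k, μ)` and `· ≤ μ`, or for `<`. -/
theorem iSup_summand {S : ∀ k, Λ k → Submodule R (H k)}
    (hS : ∀ k, DirectSum.IsInternal (S k)) (k : K) (p : (Σₗ k, Λ k) → Prop) (q : Λ k → Prop)
    (hlt : ∀ k' < k, ∀ μ', p (toLex ⟨k', μ'⟩)) (hgt : ∀ k' > k, ∀ μ', ¬ p (toLex ⟨k', μ'⟩))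
    (heq : ∀ μ', p (toLex ⟨k, μ'⟩) ↔ q μ') :
    ⨆ m, ⨆ _ : p m, T.summand S m = T.lowerPart k (⨆ m, ⨆ _ : q m, S k m) := by
  choose P hP using fun k => exists_isProjFamily (hS k)
  ext x
  rw [(T.isProjFamily hP).mem_iSup_iff, mem_lowerPart]
  constructor
  · intro h
    refine ⟨fun k' hk' => ?_, fun e f => ?_⟩
    · funext e f
      rw [← (hP k').sum (T.coord x k' e f)]
      exact Finset.sum_eq_zero fun μ' _ =>
        (T.layerProj_eq_zero_iff _ _ _).1 (h (toLex ⟨k', μ'⟩) (hgt k' hk' μ')) e f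
    · rw [(hP k).mem_iSup_iff]
      intro μ' hμ'
      exact (T.layerProj_eq_zero_iff _ _ _).1 (h (toLex ⟨k, μ'⟩) (by rwa [heq])) e f
  · rintro ⟨h1, h2⟩ ⟨k', μ'⟩ hm
    refine (T.layerProj_eq_zero_iff _ _ _).2 fun e f => ?_
    rcases lt_trichotomy k' k with hk | hk | hk
    · exact absurd (hlt k' hk μ') hm
    · subst hk
      exact ((hP k').mem_iSup_iff _ _).1 (h2 e f) μ' fun hq => hm ((heq μ').2 hq)
    · have : T.coord x k' = 0 := h1 k' hk
      change P k' μ' (T.coord x k' e f) = 0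
      rw [this]
      exact map_zero _

end MatrixLayers

namespace IdealChain

variable {R B I : Type*} [CommRing R] [Ring B] [Algebra R B] [LinearOrder I]
  {j : AntiInvolution R B} (C : IdealChain j I) (l : I)

theorem upTo_inv : ∀ x ∈ C.upTo l, j.toLin x ∈ C.upTo l := by
  have : C.upTo l ≤ (C.upTo l).comap j.toLin := by
    refine iSup₂_le fun m hm y hy => ?_
    refine (le_iSup₂_of_le (f := fun k (_ : k ≤ l) => C.summand k) m hm le_rfl) ?_
    rw [← C.map_inv m]
    exact ⟨y, hy, rfl⟩
  exact this

theorem proj_eq_zero_iff (x : B) : C.proj l x = 0 ↔ x ∈ C.below l :=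
  Ideal.Quotient.eq_zero_iff_mem

theorem proj_surjective : Function.Surjective (C.proj l) := Ideal.Quotient.mk_surjective

end IdealChain

namespace MatrixLayers

variable {R A K : Type*} [CommRing R] [Ring A] [Algebra R A] [LinearOrder K]
  {H : K → Type*} [∀ k, Ring (H k)] [∀ k, Algebra R (H k)] {i : AntiInvolution R A}
  {ι : ∀ k, AntiInvolution R (H k)} {E : K → Type*} [∀ k, Fintype (E k)]
  (T : MatrixLayers i ι E) {Λ : K → Type*} [∀ k, LinearOrder (Λ k)]

/-! ### The cell chain of an algebra with layers of matrices -/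

theorem exists_eq_proj (C : ∀ k, IdealChain (ι k) (Λ k)) (k : K) (μ : Λ k)
    (w : E k → E k → H k ⧸ (C k).below μ) :
    ∃ x, (∀ k' > k, T.coord x k' = 0) ∧ w = fun e f => (C k).proj μ (T.coord x k e f) := by
  choose u hu using fun e f => (C k).proj_surjective μ (w e f)
  refine ⟨T.ofLayer k u, T.coord_ofLayer_gt k u, ?_⟩
  funext e f
  rw [coord_ofLayer_same, hu]

variable [Fintype K] [∀ k, Fintype (Λ k)]

theorem iSup_le_summand (C : ∀ k, IdealChain (ι k) (Λ k)) (k : K) (μ : Λ k) :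
    ⨆ m, ⨆ _ : m ≤ (toLex ⟨k, μ⟩ : Σₗ k, Λ k), T.summand (fun k => (C k).summand) m =
      T.lowerPart k ((C k).upTo μ) :=
  T.iSup_summand (fun k => (C k).internal) k _ (· ≤ μ) (fun _ h _ => (toLex_lt_of_lt h _ _).le)
    (fun _ h _ => (toLex_lt_of_lt h _ _).not_ge) fun μ' => toLex_le_iff μ' μ

theorem iSup_lt_summand (C : ∀ k, IdealChain (ι k) (Λ k)) (k : K) (μ : Λ k) :
    ⨆ m, ⨆ _ : m < (toLex ⟨k, μ⟩ : Σₗ k, Λ k), T.summand (fun k => (C k).summand) m =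
      T.lowerPart k ((C k).belowSub μ) :=
  T.iSup_summand (fun k => (C k).internal) k _ (· < μ) (fun _ h _ => toLex_lt_of_lt h _ _)
    (fun _ h _ => (toLex_lt_of_lt h _ _).not_gt) fun μ' => toLex_lt_iff μ' μ

/-- The chain of ideals of `A` given by chains of ideals of the algebras `H k`. -/
def idealChain (C : ∀ k, IdealChain (ι k) (Λ k)) : IdealChain i (Σₗ k, Λ k) where
  summand := T.summand fun k => (C k).summand
  internal := by
    choose P hP using fun k => exists_isProjFamily (C k).internal
    exact (T.isProjFamily hP).isInternal
  map_inv := by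
    rintro ⟨k, μ⟩
    have h : ∀ x ∈ T.layerPart k ((C k).summand μ), i.toLin x ∈ T.layerPart k ((C k).summand μ) :=
      fun x => T.inv_mem_layerPart fun y hy => by
        rw [← (C k).map_inv μ]; exact Submodule.mem_map_of_mem hy
    apply le_antisymm
    · rintro _ ⟨x, hx, rfl⟩
      exact h x hx
    · intro x hx
      exact ⟨_, h x hx, i.invol x⟩
  mul_left := by
    rintro ⟨k, μ⟩ a x hx
    have h := T.iSup_le_summand C k μ
    exact h.ge (T.mul_mem_lowerPart ((C k).mul_left μ) a (h.le hx))
  mul_right := by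
    rintro ⟨k, μ⟩ a x hx
    have h := T.iSup_le_summand C k μ
    refine h.ge ?_
    -- `x * a = i (i a * i x)`
    rw [← i.invol (x * a), i.map_mul]
    exact T.inv_mem_lowerPart ((C k).upTo_inv μ) (T.mul_mem_lowerPart ((C k).mul_left μ) _
      (T.inv_mem_lowerPart ((C k).upTo_inv μ) (h.le hx)))

variable (C : ∀ k, IdealChain (ι k) (Λ k)) (k : K) (μ : Λ k)

theorem upTo_idealChain : (T.idealChain C).upTo (toLex ⟨k, μ⟩) = T.lowerPart k ((C k).upTo μ) :=
  T.iSup_le_summand C k μ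

theorem mem_below_idealChain (x : A) :
    x ∈ (T.idealChain C).below (toLex ⟨k, μ⟩) ↔ x ∈ T.lowerPart k ((C k).belowSub μ) := by
  rw [← T.iSup_lt_summand C k μ]
  rfl

/-- Modulo lower ideals, an element of the filtration is the matrix of its entries in layer `k`,
read modulo lower ideals of `H k`. -/
theorem exists_levelMap : ∃ L : (E k → E k → H k ⧸ (C k).below μ) →ₗ[R]
      A ⧸ (T.idealChain C).below (toLex ⟨k, μ⟩), Function.Injective L ∧
    ∀ x, (∀ k' > k, T.coord x k' = 0) → (T.idealChain C).proj (toLex ⟨k, μ⟩) x =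
      L fun e f => (C k).proj μ (T.coord x k e f) := by
  let X := T.lowerPart k ⊤
  let g : X →ₗ[R] (E k → E k → H k ⧸ (C k).below μ) :=
    (LinearMap.pi fun e => LinearMap.pi fun f =>
      (C k).proj μ ∘ₗ LinearMap.proj f ∘ₗ LinearMap.proj e ∘ₗ LinearMap.proj k) ∘ₗ
        T.coord.toLinearMap ∘ₗ X.subtype
  obtain ⟨L, hL, h⟩ := exists_injective_comp_eq g
    ((T.idealChain C).proj (toLex ⟨k, μ⟩) ∘ₗ X.subtype) (by
      intro w
      choose u hu using fun e f => (C k).proj_surjective μ (w e f)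
      refine ⟨⟨T.ofLayer k u, T.coord_ofLayer_gt k u, fun _ _ => trivial⟩, ?_⟩
      funext e f
      change (C k).proj μ (T.coord (T.ofLayer k u) k e f) = w e f
      rw [coord_ofLayer_same, hu]) (by
      rintro ⟨x, hx⟩
      change _ ↔ (T.idealChain C).proj (toLex ⟨k, μ⟩) x = 0
      rw [IdealChain.proj_eq_zero_iff, mem_below_idealChain, mem_lowerPart]
      constructor
      · intro h
        exact ⟨hx.1, fun e f => ((C k).proj_eq_zero_iff μ _).1 (congrFun (congrFun h e) f)⟩
      · intro h
        funext e f
        exact ((C k).proj_eq_zero_iff μ _).2 (h.2 e f))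
  exact ⟨L, hL, fun x hx => (h ⟨x, hx, fun _ _ => trivial⟩).symm⟩

/-- The identification of the matrices over a quotient of `H k` with elements of the corresponding
quotient of `A`. -/
def levelMap : (E k → E k → H k ⧸ (C k).below μ) →ₗ[R]
    A ⧸ (T.idealChain C).below (toLex ⟨k, μ⟩) := (T.exists_levelMap C k μ).choose

theorem levelMap_injective : Function.Injective (T.levelMap C k μ) :=
  (T.exists_levelMap C k μ).choose_spec.1

theorem proj_eq_levelMap {x : A} (hx : ∀ k' > k, T.coord x k' = 0) :
    (T.idealChain C).proj (toLex ⟨k, μ⟩) x =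
      T.levelMap C k μ fun e f => (C k).proj μ (T.coord x k e f) :=
  (T.exists_levelMap C k μ).choose_spec.2 x hx

theorem levelMap_inv (w : E k → E k → H k ⧸ (C k).below μ) :
    (i.quotient _ ((T.idealChain C).below_inv (toLex ⟨k, μ⟩))).toLin (T.levelMap C k μ w) =
      T.levelMap C k μ fun e f => ((ι k).quotient _ ((C k).below_inv μ)).toLin (w f e) := by
  obtain ⟨x, hx, rfl⟩ := T.exists_eq_proj C k μ w
  rw [← T.proj_eq_levelMap C k μ hx]
  have h := T.proj_eq_levelMap C k μ (x := i.toLin x) (fun k' hk' => by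
    funext e f
    rw [T.coord_inv, hx k' hk']
    exact map_zero _)
  refine h.trans ?_
  congr 1
  funext e f
  rw [T.coord_inv]
  rfl

theorem levelMap_mul (a : A ⧸ (T.idealChain C).below (toLex ⟨k, μ⟩)) :
    ∃ M : E k → E k → H k ⧸ (C k).below μ, ∀ w, a * T.levelMap C k μ w =
      T.levelMap C k μ fun e' f => ∑ e, M e' e * w e f := by
  obtain ⟨a, rfl⟩ := (T.idealChain C).proj_surjective (toLex ⟨k, μ⟩) a
  obtain ⟨M, hM⟩ := T.coord_mul a k
  refine ⟨fun e' e => (C k).proj μ (M e' e), fun w => ?_⟩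
  obtain ⟨x, hx, rfl⟩ := T.exists_eq_proj C k μ w
  obtain ⟨h1, h2⟩ := hM x hx
  rw [← T.proj_eq_levelMap C k μ hx]
  refine (T.proj_eq_levelMap C k μ h1).trans ?_
  congr 1
  funext e' f
  rw [h2, map_sum]
  rfl

theorem map_proj_upTo : ((T.idealChain C).upTo (toLex ⟨k, μ⟩)).map
      ((T.idealChain C).proj (toLex ⟨k, μ⟩)) =
    (matMap (T.levelMap C k μ) (((C k).upTo μ).map ((C k).proj μ))).range := by
  rw [upTo_idealChain]
  ext y
  constructor
  · rintro ⟨x, hx, rfl⟩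
    refine ⟨fun f e => ⟨_, Submodule.mem_map_of_mem (hx.2 e f)⟩, ?_⟩
    rw [T.proj_eq_levelMap C k μ hx.1]
    rfl
  · rintro ⟨w, rfl⟩
    choose u hu hw using fun f e => (w f e).2
    refine ⟨T.ofLayer k fun e f => u f e, ⟨T.coord_ofLayer_gt k _, fun e f => ?_⟩, ?_⟩
    · rw [coord_ofLayer_same]
      exact hu f e
    · rw [T.proj_eq_levelMap C k μ (T.coord_ofLayer_gt k _), coord_ofLayer_same, matMap_apply]
      congr 1
      funext e f
      exact hw f e

/-- Cell chains of the algebras `H k` give a cell chain of `A`. The cell module at `(k, μ)` consists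
of the columns over the cell module at `μ`, multiplied by the row `v k`. -/
theorem exists_cellChain (C : ∀ k, CellChain (ι k) (Λ k)) (v : ∀ k, E k → R)
    (hv : ∀ k r, (∀ f, r * v k f = 0) → r = 0) :
    ∃ D : CellChain i (Σₗ k, Λ k), ∀ k μ,
      D.summand (toLex ⟨k, μ⟩) = T.layerPart k ((C k).summand μ) ∧
      ∃ Θ : (E k → (C k).cell μ) ≃ₗ[R] D.cell (toLex ⟨k, μ⟩),
        ∀ (u : E k → H k) (hu : ∀ e, (C k).proj μ (u e) ∈ (C k).cell μ),
          (Θ fun e => ⟨(C k).proj μ (u e), hu e⟩).1 =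
            D.proj (toLex ⟨k, μ⟩) (T.ofLayer k fun e f => v k f • u e) := by
  classical
  let C' := fun k => (C k).toIdealChain
  let D : CellChain i (Σₗ k, Λ k) :=
    { toIdealChain := T.idealChain C'
      cell := fun l => (colMap (T.levelMap C' (ofLex l).1 (ofLex l).2) (v _)
        ((C (ofLex l).1).cell (ofLex l).2)).range
      isCellIdeal := by
        rintro ⟨k, μ⟩
        have h := IsCellIdeal.inflate (T.levelMap_injective C' k μ) (hv k) (T.levelMap_inv C' k μ)
          (T.levelMap_mul C' k μ) ((C k).isCellIdeal μ)
        rw [← T.map_proj_upTo C' k μ] at h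
        exact h }
  refine ⟨D, fun k μ => ⟨rfl, ?_⟩⟩
  have := ((C k).isCellIdeal μ).free
  refine ⟨LinearEquiv.ofInjective _ (colMap_injective (T.levelMap_injective C' k μ) (hv k)
    ((C k).cell μ)), fun u hu => ?_⟩
  change T.levelMap C' k μ (fun e f => v k f • (C' k).proj μ (u e)) =
    (T.idealChain C').proj (toLex ⟨k, μ⟩) (T.ofLayer k fun e f => v k f • u e)
  rw [T.proj_eq_levelMap C' k μ (T.coord_ofLayer_gt k _), coord_ofLayer_same]
  simp only [map_smul]

end MatrixLayers

/-! ### Multiplication of symmetric diagrams -/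

namespace SymDangle

variable {n k : ℕ}

instance : Finite (SymDangle n k) :=
  Finite.of_injective (fun (e : SymDangle n k) (x y : Fin (2 * n)) => e.rel x y) fun e f h => by
    ext x y
    exact iff_of_eq (congrFun (congrFun h x) y)

instance : Fintype (SymDangle n k) := Fintype.ofFinite _

theorem rel_le_of_comp_eq_south {k' : ℕ} {d : BrauerDiagram (2 * n)} {e f : SymDangle n k}
    {e' f' : SymDangle n k'} {π : Equiv.Perm (Fin (2 * (n - k)))}
    {π' : Equiv.Perm (Fin (2 * (n - k')))} (h : d.comp (glue e f π) = glue e' f' π') (x y)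
    (hxy : f.rel x y) : f'.rel x y := by
  have h1 : (d.comp (glue e f π)).rel (.inr x) (.inr y) :=
    stack_lower (p := d.rel) (q := (glue e f π).rel) (a := .inr x) (b := .inr y) hxy
  rw [h] at h1
  exact h1

theorem rel_le_of_comp_eq_north {k' : ℕ} {d : BrauerDiagram (2 * n)} {e f : SymDangle n k}
    {e' f' : SymDangle n k'} {π : Equiv.Perm (Fin (2 * (n - k)))}
    {π' : Equiv.Perm (Fin (2 * (n - k')))} (h : (glue e f π).comp d = glue e' f' π') (x y)
    (hxy : e.rel x y) : e'.rel x y := by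
  have h1 : ((glue e f π).comp d).rel (.inl x) (.inl y) :=
    stack_upper (p := (glue e f π).rel) (q := d.rel) (a := .inl x) (b := .inl y) hxy
  rw [h] at h1
  exact h1

/-- A symmetric diagram acts on the diagrams with northern dangle `e` by changing the northern
dangle and multiplying the permutation from the left, unless it creates new arcs. As `δ` is
invertible, the diagram with dangles `e`, `e` and identity permutation is a multiple of an
idempotent that fixes these diagrams, so that only its product with `d` has to be considered. -/
theorem diag_mul_glue {R : Type*} [CommRing R] {δ : R} (hδ : IsUnit δ)
    {d : BrauerDiagram (2 * n)} (hd : d.IsSymmetric) (e : SymDangle n k) :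
    (∀ (f : SymDangle n k) (π : Equiv.Perm (Fin (2 * (n - k)))) (k' : ℕ) (e' f' : SymDangle n k')
      (π' : Equiv.Perm (Fin (2 * (n - k')))), d.comp (glue e f π) = glue e' f' π' → k < k') ∨
    ∃ (e' : SymDangle n k) (τ : Hyperoctahedral (n - k)) (c : R), ∀ f π,
      (BrauerAlgebra.diag d * BrauerAlgebra.diag (glue e f π) : BrauerAlgebra R δ (2 * n)) =
        c • BrauerAlgebra.diag (glue e' f (τ.1 * π)) := by
  obtain ⟨k', e', f', τ, h⟩ := (hd.comp (glue_isSymmetric e e 1)).exists_glue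
  have hef := rel_le_of_comp_eq_south h.symm
  have hassoc : ∀ (f : SymDangle n k) (π : Equiv.Perm (Fin (2 * (n - k)))),
      d.comp (glue e f π) = (glue e' f' τ.1).comp (glue e f π) := by
    intro f π
    rw [h]
    have h1 : (d.comp (glue e e 1)).comp (glue e f π) = d.comp ((glue e e 1).comp (glue e f π)) :=
      BrauerDiagram.ext (comp_assoc _ _ _)
    refine Eq.trans ?_ h1.symm
    rw [glue_comp_glue, one_mul]
  rcases (e.le_of_rel_le f' hef).lt_or_eq with hlt | heq
  · left
    intro f π k'' e'' f'' π'' h2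
    rw [hassoc] at h2
    exact hlt.trans_le (e'.le_of_rel_le e'' (rel_le_of_comp_eq_north h2))
  · right
    obtain ⟨k', hk'⟩ := k'
    change k = k' at heq
    subst heq
    obtain rfl : e = f' := e.eq_of_rel_le f' hef
    obtain ⟨u, rfl⟩ := hδ
    refine ⟨e', τ, (u : R) ^ d.loops (glue e e 1), fun f π => ?_⟩
    have hl : ∀ (e₁ : SymDangle n k) (τ : Equiv.Perm (Fin (2 * (n - k)))),
        (BrauerAlgebra.diag (glue e₁ e τ) * BrauerAlgebra.diag (glue e f π) :
          BrauerAlgebra R (u : R) (2 * n)) =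
        (u : R) ^ (glue e e 1).loops (glue e e 1) • BrauerAlgebra.diag (glue e₁ f (τ * π)) := by
      intro e₁ τ
      rw [BrauerAlgebra.diag_mul_diag, glue_comp_glue, loops_glue]
    set l := (glue e e 1).loops (glue e e 1)
    have h1 := hl e 1
    rw [one_mul] at h1
    have h2 : ((u : R) ^ l) • (BrauerAlgebra.diag d * BrauerAlgebra.diag (glue e f π) :
        BrauerAlgebra R (u : R) (2 * n)) = (u : R) ^ l • (u : R) ^ d.loops (glue e e 1) •
          BrauerAlgebra.diag (glue e' f (τ.1 * π)) := by
      rw [← mul_smul_comm, ← h1, ← mul_assoc, BrauerAlgebra.diag_mul_diag d]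
      have h3 : d.comp (glue e e 1) = glue e' e τ.1 := h.symm
      rw [h3, smul_mul_assoc, hl, smul_comm]
    exact (u.isUnit.pow l).smul_left_cancel.1 h2

end SymDangle

/-! ### The basis of symmetric diagrams -/

section Basis

variable (R : Type*) [CommRing R] (δ : R) (n : ℕ)

/-- The symmetric dangles of a layer. Layers are indexed by the number of arcs, with the order
reversed, since the diagrams with more arcs span the smaller ideals. -/
abbrev Dangles (n : ℕ) (k : (Fin (n + 1))ᵒᵈ) : Type :=
  SymDangle n (OrderDual.ofDual k : Fin (n + 1))

/-- The permutations of the vertical lines in a layer. -/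
abbrev Lines (n : ℕ) (k : (Fin (n + 1))ᵒᵈ) : Type :=
  Hyperoctahedral (n - (OrderDual.ofDual k : Fin (n + 1)))

/-- The triples of two symmetric dangles and an element of a hyperoctahedral group. -/
abbrev Triple (n : ℕ) : Type :=
  Σ k : (Fin (n + 1))ᵒᵈ, Dangles n k × Dangles n k ×
    Lines n k

/-- The diagram of a triple. -/
def Triple.diagram {n : ℕ} (t : Triple n) : BrauerDiagram (2 * n) :=
  SymDangle.glue t.2.1 t.2.2.1 t.2.2.2.1

theorem Triple.diagram_injective : Function.Injective (Triple.diagram (n := n)) := by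
  rintro ⟨k, e, f, π⟩ ⟨k', e', f', π'⟩ h
  obtain ⟨h1, -⟩ := SymDangle.rel_iff_of_glue_eq h
  obtain rfl : k = k' := Fin.ext (le_antisymm (e.le_of_rel_le e' fun x y => (h1 x y).1)
    (e'.le_of_rel_le e fun x y => (h1 x y).2))
  obtain ⟨rfl, rfl, h2⟩ := SymDangle.glue_injective h
  obtain rfl : π = π' := Subtype.ext h2
  rfl

theorem linearIndependent_diagram : LinearIndependent R fun t : Triple n =>
    (BrauerAlgebra.diag t.diagram : BrauerAlgebra R δ (2 * n)) :=
  (Finsupp.basisSingleOne (R := R) (ι := BrauerDiagram (2 * n))).linearIndependent.comp _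
    (Triple.diagram_injective n)

/-- The basis of the algebra of type `C_n` given by the symmetric diagrams. -/
def symBasis : Module.Basis (Triple n) R (typeC R δ n) :=
  Module.Basis.mk (v := fun t => layerDiag R δ n _ t.2.1 t.2.2.1 t.2.2.2)
    (LinearIndependent.of_comp (typeC R δ n).val.toLinearMap
      (linearIndependent_diagram R δ n)) <| by
      rintro ⟨x, hx⟩ -
      have hle : Submodule.span R {x | ∃ d : BrauerDiagram (2 * n), d.IsSymmetric ∧
          x = BrauerAlgebra.diag d} ≤ (Submodule.span R (Set.range fun t : Triple n =>
            layerDiag R δ n _ t.2.1 t.2.2.1 t.2.2.2)).map (typeC R δ n).val.toLinearMap := by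
        rw [Submodule.span_le]
        rintro _ ⟨d, hd, rfl⟩
        obtain ⟨k, e, f, π, rfl⟩ := hd.exists_glue
        exact ⟨_, Submodule.subset_span ⟨⟨OrderDual.toDual k, e, f, π⟩, rfl⟩, rfl⟩
      obtain ⟨y, hy, hyx⟩ := hle hx
      obtain rfl : y = ⟨x, hx⟩ := Subtype.ext hyx
      exact hy

theorem symBasis_apply (k : (Fin (n + 1))ᵒᵈ) (e f : Dangles n k)
    (π : Lines n k) :
    symBasis R δ n ⟨k, e, f, π⟩ = layerDiag R δ n _ e f π := by
  rw [symBasis, Module.Basis.mk_apply]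

/-- The coordinates of an element with respect to the symmetric diagrams, arranged as matrices over
the group algebras of the hyperoctahedral groups. -/
def symCoord : typeC R δ n ≃ₗ[R] ∀ k : (Fin (n + 1))ᵒᵈ, Dangles n k →
    Dangles n k →
      MonoidAlgebra R (Lines n k) :=
  (symBasis R δ n).repr ≪≫ₗ Finsupp.linearEquivFunOnFinite R R (Triple n) ≪≫ₗ
    LinearEquiv.piCurry R (fun _ _ => R) ≪≫ₗ LinearEquiv.piCongrRight fun _ =>
      LinearEquiv.curry R R _ _ ≪≫ₗ LinearEquiv.piCongrRight fun _ =>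
        LinearEquiv.curry R R _ _ ≪≫ₗ LinearEquiv.piCongrRight fun _ =>
          (Finsupp.linearEquivFunOnFinite R R _).symm ≪≫ₗ (MonoidAlgebra.coeffLinearEquiv R).symm

theorem coeff_symCoord (x : typeC R δ n) (k : (Fin (n + 1))ᵒᵈ)
    (e f : Dangles n k)
    (π : Lines n k) :
    (symCoord R δ n x k e f).coeff π = (symBasis R δ n).repr x ⟨k, e, f, π⟩ := rfl

theorem symCoord_layerDiag_of_ne (k k' : (Fin (n + 1))ᵒᵈ) (hk : k' ≠ k)
    (e f : Dangles n k)
    (π : Lines n k) :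
    symCoord R δ n (layerDiag R δ n _ e f π) k' = 0 := by
  classical
  funext e' f'
  ext π'
  rw [coeff_symCoord, ← symBasis_apply, Module.Basis.repr_self, Finsupp.single_apply, if_neg]
  · rfl
  · intro h
    exact hk (congrArg Sigma.fst h).symm

open Classical in
theorem symCoord_layerDiag (k : (Fin (n + 1))ᵒᵈ) (e f e' f' : Dangles n k)
    (π : Lines n k) :
    symCoord R δ n (layerDiag R δ n _ e f π) k e' f' =
      if e' = e ∧ f' = f then MonoidAlgebra.single π 1 else 0 := by
  ext π'
  rw [coeff_symCoord, ← symBasis_apply, Module.Basis.repr_self, Finsupp.single_apply]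
  split_ifs with h1 h2 h2
  · simp only [Sigma.mk.injEq, heq_eq_eq, Prod.mk.injEq, true_and] at h1
    simp [h1.2.2]
  · simp only [Sigma.mk.injEq, heq_eq_eq, Prod.mk.injEq, true_and] at h1
    exact absurd ⟨h1.1.symm, h1.2.1.symm⟩ h2
  · obtain ⟨rfl, rfl⟩ := h2
    simp only [Sigma.mk.injEq, heq_eq_eq, Prod.mk.injEq, true_and] at h1
    simp [h1]
  · rfl

end Basis

/-! ### The layers of the algebra of type `C_n` -/

variable (R : Type*) [CommRing R] (δ : R) (n : ℕ)

theorem typeCFlip_layerDiag {k : ℕ} (e f : SymDangle n k) (π : Hyperoctahedral (n - k)) :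
    (typeCFlip R δ n).toLin (layerDiag R δ n k e f π) = layerDiag R δ n k f e π⁻¹ := by
  apply Subtype.ext
  change BrauerAlgebra.flipLin R δ (2 * n) (BrauerAlgebra.diag (SymDangle.glue e f π.1)) =
    BrauerAlgebra.diag (SymDangle.glue f e (π⁻¹).1)
  rw [BrauerAlgebra.flipLin_diag, SymDangle.flip_glue]
  rfl

theorem symCoord_inv (x : typeC R δ n) (k : (Fin (n + 1))ᵒᵈ) (e f : Dangles n k) :
    symCoord R δ n ((typeCFlip R δ n).toLin x) k e f =
      (groupInv R (Lines n k)).toLin (symCoord R δ n x k f e) := by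
  classical
  have h : (LinearMap.proj f ∘ₗ LinearMap.proj e ∘ₗ LinearMap.proj k) ∘ₗ
      (symCoord R δ n).toLinearMap ∘ₗ (typeCFlip R δ n).toLin =
      (groupInv R (Lines n k)).toLin ∘ₗ (LinearMap.proj e ∘ₗ LinearMap.proj f ∘ₗ LinearMap.proj k)
        ∘ₗ (symCoord R δ n).toLinearMap := by
    refine (symBasis R δ n).ext ?_
    rintro ⟨k', e', f', π⟩
    rw [symBasis_apply]
    change symCoord R δ n ((typeCFlip R δ n).toLin (layerDiag R δ n _ e' f' π)) k e f =
      (groupInv R (Lines n k)).toLin (symCoord R δ n (layerDiag R δ n _ e' f' π) k f e)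
    rw [typeCFlip_layerDiag]
    by_cases hk : k = k'
    · subst hk
      rw [symCoord_layerDiag, symCoord_layerDiag]
      by_cases h : e = f' ∧ f = e'
      · rw [if_pos h, if_pos h.symm]
        simp [groupInv]
      · rw [if_neg h, if_neg fun h' => h h'.symm, map_zero]
    · rw [symCoord_layerDiag_of_ne R δ n _ _ hk, symCoord_layerDiag_of_ne R δ n _ _ hk]
      exact (map_zero _).symm
  exact LinearMap.congr_fun h x

variable {δ}

open Classical in
/-- Modulo lower layers, left multiplication changes the northern dangle and the permutation of a
diagram in a way that does not depend on the southern dangle; `m` is a column of the matrix that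
describes it. -/
theorem symCoord_mul_layerDiag (hδ : IsUnit δ) (a : typeC R δ n) (k : (Fin (n + 1))ᵒᵈ)
    (e : Dangles n k) : ∃ m : Dangles n k → MonoidAlgebra R (Lines n k), ∀ f π,
      (∀ k' > k, symCoord R δ n (a * layerDiag R δ n _ e f π) k' = 0) ∧
      ∀ e' f', symCoord R δ n (a * layerDiag R δ n _ e f π) k e' f' =
        if f' = f then m e' * MonoidAlgebra.single π 1 else 0 := by
  induction (symBasis R δ n).mem_span a using Submodule.span_induction with
  | zero => exact ⟨0, fun f π => by simp⟩
  | add x y _ _ hx hy =>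
    obtain ⟨m, hm⟩ := hx
    obtain ⟨m', hm'⟩ := hy
    refine ⟨m + m', fun f π => ⟨fun k' hk' => ?_, fun e' f' => ?_⟩⟩
    · rw [add_mul, map_add, Pi.add_apply, (hm f π).1 k' hk', (hm' f π).1 k' hk', add_zero]
    · simp only [add_mul, map_add, Pi.add_apply, (hm f π).2, (hm' f π).2]
      split_ifs <;> simp
  | smul r x _ hx =>
    obtain ⟨m, hm⟩ := hx
    refine ⟨r • m, fun f π => ⟨fun k' hk' => ?_, fun e' f' => ?_⟩⟩
    · rw [smul_mul_assoc, map_smul, Pi.smul_apply, (hm f π).1 k' hk', smul_zero]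
    · simp only [smul_mul_assoc, map_smul, Pi.smul_apply, (hm f π).2]
      split_ifs <;> simp
  | mem x hx =>
    obtain ⟨⟨k₀, e₀, f₀, π₀⟩, rfl⟩ := hx
    rw [symBasis_apply]
    have hd := SymDangle.glue_isSymmetric e₀ f₀ π₀
    rcases SymDangle.diag_mul_glue hδ hd e with h | ⟨e₁, τ, c, h⟩
    · -- every product has more arcs
      refine ⟨0, fun f π => ?_⟩
      obtain ⟨k₁, e₁, f₁, π₁, h₁⟩ := (hd.comp (SymDangle.glue_isSymmetric e f π)).exists_glue
      have hlt := h f π.1 _ e₁ f₁ π₁.1 h₁.symm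
      have hprod : layerDiag R δ n _ e₀ f₀ π₀ * layerDiag R δ n _ e f π =
          δ ^ (SymDangle.glue e₀ f₀ π₀.1).loops (SymDangle.glue e f π.1) •
            layerDiag R δ n _ e₁ f₁ π₁ := by
        apply Subtype.ext
        refine (BrauerAlgebra.diag_mul_diag _ _).trans ?_
        rw [← h₁]
        rfl
      have hzero : ∀ k' ≥ k, symCoord R δ n
          (layerDiag R δ n _ e₀ f₀ π₀ * layerDiag R δ n _ e f π) k' = 0 := by
        intro k' hk'
        have hne : k' ≠ OrderDual.toDual k₁ := by
          intro h₂
          rw [h₂] at hk'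
          exact absurd (show k₁ ≤ OrderDual.ofDual k from hk') (not_le.2 hlt)
        have := symCoord_layerDiag_of_ne R δ n (OrderDual.toDual k₁) k' hne e₁ f₁ π₁
        rw [hprod, map_smul, Pi.smul_apply]
        exact (congrArg _ this).trans (smul_zero _)
      refine ⟨fun k' hk' => hzero k' hk'.le, fun e' f' => ?_⟩
      rw [hzero k le_rfl]
      simp
    · refine ⟨fun e' => if e' = e₁ then c • MonoidAlgebra.single τ 1 else 0, fun f π => ?_⟩
      have hprod : layerDiag R δ n _ e₀ f₀ π₀ * layerDiag R δ n _ e f π =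
          c • layerDiag R δ n _ e₁ f (τ * π) := Subtype.ext (h f π.1)
      refine ⟨fun k' hk' => ?_, fun e' f' => ?_⟩
      · rw [hprod, map_smul, Pi.smul_apply, symCoord_layerDiag_of_ne R δ n _ _ (ne_of_gt hk'),
          smul_zero]
      · rw [hprod, map_smul, Pi.smul_apply, Pi.smul_apply, Pi.smul_apply, symCoord_layerDiag]
        by_cases h1 : e' = e₁ <;> by_cases h2 : f' = f <;>
          simp [h1, h2, MonoidAlgebra.single_mul_single]

theorem symCoord_mul (hδ : IsUnit δ) (a : typeC R δ n) (k : (Fin (n + 1))ᵒᵈ) :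
    ∃ M : Dangles n k → Dangles n k → MonoidAlgebra R (Lines n k),
      ∀ x, (∀ k' > k, symCoord R δ n x k' = 0) → (∀ k' > k, symCoord R δ n (a * x) k' = 0) ∧
        ∀ e' f, symCoord R δ n (a * x) k e' f = ∑ e, M e' e * symCoord R δ n x k e f := by
  classical
  choose m hm using fun k => symCoord_mul_layerDiag R n hδ a k
  refine ⟨fun e' e => m k e e', fun x hx => ?_⟩
  -- `W` contains the diagrams of layer `k` and of all lower layers
  let W : Submodule R (typeC R δ n) :=
    { carrier := {x | (∀ k' > k, symCoord R δ n (a * x) k' = 0) ∧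
        ∀ e' f, symCoord R δ n (a * x) k e' f = ∑ e, m k e e' * symCoord R δ n x k e f}
      zero_mem' := by simp
      add_mem' := by
        rintro x y ⟨h1, h2⟩ ⟨h3, h4⟩
        refine ⟨fun k' hk' => ?_, fun e' f => ?_⟩
        · rw [mul_add, map_add, Pi.add_apply, h1 k' hk', h3 k' hk', add_zero]
        · simp only [mul_add, map_add, Pi.add_apply, h2, h4, Finset.sum_add_distrib]
      smul_mem' := by
        rintro r x ⟨h1, h2⟩
        refine ⟨fun k' hk' => ?_, fun e' f => ?_⟩
        · rw [mul_smul_comm, map_smul, Pi.smul_apply, h1 k' hk', smul_zero]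
        · simp only [mul_smul_comm, map_smul, Pi.smul_apply, h2, Finset.smul_sum] }
  change x ∈ W
  rw [← (symBasis R δ n).sum_repr x]
  refine Submodule.sum_mem _ fun t _ => ?_
  obtain ⟨k₁, e₁, f₁, π⟩ := t
  rcases lt_or_ge k k₁ with hk | hk
  · -- the layers above `k` do not contribute to `x`
    have : (symBasis R δ n).repr x ⟨k₁, e₁, f₁, π⟩ = 0 := by
      rw [← coeff_symCoord, hx k₁ hk]
      rfl
    rw [this, zero_smul]
    exact W.zero_mem
  refine W.smul_mem _ ?_
  rw [symBasis_apply]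
  refine ⟨fun k' hk' => (hm k₁ e₁ f₁ π).1 k' (hk.trans_lt hk'), fun e' f => ?_⟩
  rcases hk.lt_or_eq with hlt | rfl
  · rw [(hm k₁ e₁ f₁ π).1 k hlt, symCoord_layerDiag_of_ne R δ n _ _ (ne_of_gt hlt)]
    simp
  · rw [(hm k₁ e₁ f₁ π).2, Finset.sum_eq_single e₁]
    · rw [symCoord_layerDiag]
      by_cases hf : f = f₁ <;> simp [hf]
    · intro e _ he
      rw [symCoord_layerDiag, if_neg (fun h => he h.1), mul_zero]
    · simp

/-- The algebra of type `C_n` with its layers of matrices over the group algebras of the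
hyperoctahedral groups; the matrices are indexed by the symmetric dangles. -/
def typeCLayers (hδ : IsUnit δ) : MatrixLayers (typeCFlip R δ n)
    (fun k : (Fin (n + 1))ᵒᵈ => groupInv R (Lines n k)) (Dangles n) where
  coord := symCoord R δ n
  coord_inv := symCoord_inv R δ n
  coord_mul := symCoord_mul R n hδ

variable (δ)

theorem layer_single {k : ℕ} (e f : SymDangle n k) (π : Hyperoctahedral (n - k)) :
    layer R δ n k (Finsupp.single e 1) (Finsupp.single f 1) (MonoidAlgebra.single π 1) =
      layerDiag R δ n k e f π := by
  simp [layer]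

/-- The element `a ⊗ b ⊗ h` is the matrix with entries `(b f * a e) • h`. -/
theorem symCoord_layer (k : (Fin (n + 1))ᵒᵈ)
    (a b : DangleModule R n (OrderDual.ofDual k : Fin (n + 1)))
    (h : MonoidAlgebra R (Lines n k)) :
    symCoord R δ n (layer R δ n _ a b h) = Pi.single k fun e f => (b f * a e) • h := by
  classical
  induction a using Finsupp.induction_linear with
  | zero =>
    simp only [map_zero, LinearMap.zero_apply, Finsupp.zero_apply, mul_zero, zero_smul]
    exact (Pi.single_eq_zero_iff.2 rfl).symm
  | add a a' h1 h2 =>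
    rw [map_add, LinearMap.add_apply, LinearMap.add_apply, map_add, h1, h2, ← Pi.single_add]
    congr 1
    funext e f
    simp [mul_add, add_smul]
  | single e r =>
    induction b using Finsupp.induction_linear with
    | zero =>
      simp only [map_zero, LinearMap.zero_apply, Finsupp.zero_apply, zero_mul, zero_smul]
      exact (Pi.single_eq_zero_iff.2 rfl).symm
    | add b b' h1 h2 =>
      rw [map_add, LinearMap.add_apply, map_add, h1, h2, ← Pi.single_add]
      congr 1
      funext e f
      simp [add_mul, add_smul]
    | single f s =>
      induction h using MonoidAlgebra.induction_linear with
      | zero =>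
        simp only [map_zero, smul_zero]
        exact (Pi.single_eq_zero_iff.2 rfl).symm
      | add h h' h1 h2 =>
        rw [map_add, map_add, h1, h2, ← Pi.single_add]
        congr 1
        funext e f
        simp [smul_add]
      | single π t =>
        have h1 : layer R δ n _ (Finsupp.single e r) (Finsupp.single f s)
            (MonoidAlgebra.single π t) = (r * s * t) • layerDiag R δ n _ e f π := by
          rw [← layer_single, ← Finsupp.smul_single_one e r, ← Finsupp.smul_single_one f s]
          rw [show (MonoidAlgebra.single π t : MonoidAlgebra R (Lines n k)) =
            t • MonoidAlgebra.single π 1 by simp]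
          simp only [map_smul, LinearMap.smul_apply, smul_smul]
          congr 1
          ring
        rw [h1, map_smul]
        funext k'
        by_cases hk : k' = k
        · subst hk
          rw [Pi.single_eq_same, Pi.smul_apply]
          funext e' f'
          rw [Pi.smul_apply, Pi.smul_apply, symCoord_layerDiag]
          by_cases he : e = e' <;> by_cases hf : f = f' <;>
            simp [he, hf, eq_comm, mul_comm, mul_left_comm]
        · rw [Pi.smul_apply, symCoord_layerDiag_of_ne R δ n _ _ hk, Pi.single_eq_of_ne hk,
            smul_zero]

variable {δ}

theorem typeCLayers_layerPart (hδ : IsUnit δ) (k : (Fin (n + 1))ᵒᵈ)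
    (S : Submodule R (MonoidAlgebra R (Lines n k))) :
    (typeCLayers R n hδ).layerPart k S =
      Submodule.span R {x | ∃ a b, ∃ h ∈ S, x = layer R δ n _ a b h} := by
  apply le_antisymm
  · rintro x ⟨h1, h2⟩
    have hx : x = ∑ e, ∑ f, layer R δ n _ (Finsupp.single e 1) (Finsupp.single f 1)
        (symCoord R δ n x k e f) := by
      classical
      apply (symCoord R δ n).injective
      simp only [map_sum, symCoord_layer]
      funext k'
      by_cases hk : k' = k
      · subst hk
        funext e' f'
        simp [Finset.sum_apply, Finsupp.single_apply]
      · refine (h1 k' hk).trans ?_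
        simp [Finset.sum_apply, Pi.single_eq_of_ne hk]
    rw [hx]
    exact Submodule.sum_mem _ fun e _ => Submodule.sum_mem _ fun f _ =>
      Submodule.subset_span ⟨_, _, _, h2 e f, rfl⟩
  · rw [Submodule.span_le]
    rintro _ ⟨a, b, h, hh, rfl⟩
    refine ⟨fun k' hk' => ?_, fun e f => ?_⟩
    · exact (congrFun (symCoord_layer R δ n k a b h) k').trans (Pi.single_eq_of_ne hk' _)
    · have := congrFun (symCoord_layer R δ n k a b h) k
      rw [Pi.single_eq_same] at this
      exact (congrFun (congrFun this e) f) ▸ S.smul_mem _ hh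

theorem typeCLayers_ofLayer (hδ : IsUnit δ) (k : (Fin (n + 1))ᵒᵈ)
    (a b : DangleModule R n (OrderDual.ofDual k : Fin (n + 1)))
    (h : MonoidAlgebra R (Lines n k)) :
    (typeCLayers R n hδ).ofLayer k (fun e f => b f • a e • h) = layer R δ n _ a b h := by
  apply (symCoord R δ n).injective
  rw [symCoord_layer]
  simp only [← smul_smul]
  exact (typeCLayers R n hδ).coord_ofLayer k _

end BrauerC

end

theorem mainTheorem4 {R : Type*} [CommRing R] (δ : R) (hδ : IsUnit δ) (n : ℕ)
    (Λ : Fin (n + 1) → Type*) [∀ k, LinearOrder (Λ k)] [∀ k, Finite (Λ k)]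
    (C : ∀ k : Fin (n + 1),
      BrauerC.CellChain (BrauerC.groupInv R (BrauerC.Hyperoctahedral (n - k))) (Λ k))
    (v : ∀ k : Fin (n + 1), BrauerC.DangleModule R n k)
    (hv : ∀ (k : Fin (n + 1)) (r : R), r • v k = 0 → r = 0) :
    ∃ D : BrauerC.CellChain (BrauerC.typeCFlip R δ n)
        (Σₗ k : (Fin (n + 1))ᵒᵈ, Λ (OrderDual.ofDual k)),
      ∀ (k : Fin (n + 1)) (μ : Λ k),
        D.summand (toLex ⟨OrderDual.toDual k, μ⟩) =
          Submodule.span R {x | ∃ a b, ∃ h ∈ (C k).summand μ, x = BrauerC.layer R δ n k a b h} ∧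
        ∃ Θ : (BrauerC.DangleModule R n k ⊗[R] (C k).cell μ) ≃ₗ[R]
            D.cell (toLex ⟨OrderDual.toDual k, μ⟩),
          ∀ (a : BrauerC.DangleModule R n k)
            (h : MonoidAlgebra R (BrauerC.Hyperoctahedral (n - k)))
            (hh : (C k).proj μ h ∈ (C k).cell μ),
            (Θ (a ⊗ₜ ⟨(C k).proj μ h, hh⟩)).1 =
              D.proj (toLex ⟨OrderDual.toDual k, μ⟩) (BrauerC.layer R δ n k a (v k) h) := by
  classical
  have : ∀ k : (Fin (n + 1))ᵒᵈ, Fintype (Λ (OrderDual.ofDual k)) := fun k => Fintype.ofFinite _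
  obtain ⟨D, hD⟩ := (BrauerC.typeCLayers R n hδ).exists_cellChain
    (fun k => C (OrderDual.ofDual k)) (fun k f => v (OrderDual.ofDual k) f)
    (fun k r hr => hv (OrderDual.ofDual k) r (Finsupp.ext hr))
  refine ⟨D, fun k μ => ?_⟩
  obtain ⟨h1, Θ, hΘ⟩ := hD (OrderDual.toDual k) μ
  refine ⟨h1.trans (BrauerC.typeCLayers_layerPart R n hδ (OrderDual.toDual k) ((C k).summand μ)),
    TensorProduct.finsuppScalarLeft R _ _ ≪≫ₗ Finsupp.linearEquivFunOnFinite R _ _ ≪≫ₗ Θ,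
    fun a h hh => ?_⟩
  have hmem : ∀ e, (C k).proj μ (a e • h) ∈ (C k).cell μ := fun e => by
    rw [map_smul]
    exact Submodule.smul_mem _ _ hh
  have h2 : Finsupp.linearEquivFunOnFinite R _ _ (TensorProduct.finsuppScalarLeft R _ _
      (a ⊗ₜ[R] (⟨(C k).proj μ h, hh⟩ : (C k).cell μ))) =
      fun e => (⟨(C k).proj μ (a e • h), hmem e⟩ : (C k).cell μ) := by
    funext e
    apply Subtype.ext
    refine (congrArg Subtype.val (TensorProduct.finsuppScalarLeft_apply_tmul_apply a _ e)).trans ?_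
    exact (map_smul ((C k).proj μ) (a e) h).symm
  refine (congrArg (fun u => (Θ u).1) h2).trans ((hΘ (fun e => a e • h) hmem).trans ?_)
  exact congrArg (D.proj (toLex ⟨OrderDual.toDual k, μ⟩))
    (BrauerC.typeCLayers_ofLayer R n hδ (OrderDual.toDual k) a (v k) h)
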